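/- **Setting.** Let $d\ge 0$, $\Omega=\mathbb R^d$ with Euclidean norm $|\cdot|$ and Lebesgue measure, and let $\mathcal H_0$ be a real Hilbert space. Fix pooling scales $\sigma_0,\sigma_1,\sigma_2,\dots>0$, compact patch shapes $S_1,S_2,\dots\subset\Omega$ of positive Lebesgue measure, and functions $\kappa_k(t)=\sum_{j\ge 0} b_{k,j}t^j$ on $[-1,1]$ with $b_{k,j}\ge 0$, $\sum_j b_{k,j}<\infty$, $\sum_j j\,b_{k,j}<\infty$, $\kappa_k(1)=1$ and $\kappa_k'(1)=1$ ($k\ge1$). For $k\ge 1$ define recursively: - the patch space $\mathcal P_k=L^2(S_k,\mathcal H_{k-1})$ with respect to the normalized uniform measure on $S_k$, and the patch extraction operator $P_kx(u)=(v\mapsto x(u+v))_{v\in S_k}\in\mathcal P_k$; - the reproducing kernel Hilbert space $\mathcal H_k$ of the kernel $K_k(z,z')=\|z\|\|z'\|\,\kappa_k\big(\langle z,z'\rangle/(\|z\|\|z'\|)\big)$ on $\mathcal P_k$ (with $K_k(z,z')=0$ if $z=0$ or $z'=0$), its canonical mapping $\varphi_k:\mathcal P_k\to\mathcal H_k$,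 and the pointwise operator $M_kz(u)=\varphi_k(z(u))$. Let $h(u)=(2\pi)^{-d/2}e^{-|u|^2/2}$, $h_\sigma(u)=\sigma^{-d}h(u/\sigma)$, and for $k\ge 0$ let $A_kx(u)=\int_{\mathbb R^d}h_{\sigma_k}(u-v)x(v)\,dv$. For $x\in L^2(\Omega,\mathcal H_0)$ and $n\ge 0$ put $$\Phi_n(x)=A_nM_nP_n\,A_{n-1}M_{n-1}P_{n-1}\cdots A_1M_1P_1\,A_0x .$$ For a $C^1$ map $\tau:\Omega\to\Omega$ let $L_\tau x(u)=x(u-\tau(u))$, $\|\nabla\tau\|_\infty=\sup_u\|\nabla\tau(u)\|$ (operator norm of the Jacobian) and $\|\tau\|_\infty=\sup_u|\tau(u)|\in[0,\infty]$. **Theorem (stability bound).** For every $d$ and every $\kappa>0$ there is a constant $C_1\ge 0$, depending only on $d$ and $\kappa$, such that the following holds with $C_2=2^d\,\|\nabla h\|_{L^1(\mathbb R^d)}$. For all $\mathcal H_0$, $(\sigma_k)$, $(S_k)$, $(\kappa_k)$ as above and all $n\ge 0$ such that $$\sup_{c\in S_k}|c|\le\kappa\,\sigma_{k-1}\qquad(1\le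 k\le n),$$ for every $C^1$ map $\tau:\Omega\to\Omega$ with $\|\nabla\tau\|_\infty\le 1/2$ and every $x\in L^2(\Omega,\mathcal H_0)$, one has $L_\tau x\in L^2(\Omega,\mathcal H_0)$, $\Phi_n(x),\Phi_n(L_\tau x)\in L^2(\Omega,\mathcal H_n)$ and $$\|\Phi_n(L_\tau x)-\Phi_n(x)\|\le\Big(C_1(1+n)\|\nabla\tau\|_\infty+\frac{C_2}{\sigma_n}\|\tau\|_\infty\Big)\|x\|,$$ where the norms are those of $L^2(\Omega,\mathcal H_n)$ and $L^2(\Omega,\mathcal H_0)$ (and $\infty\cdot 0=0$ on the right-hand side). -/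

import Mathlib

open MeasureTheory
open scoped ENNReal InnerProductSpace

universe u

noncomputable section

namespace ConvKernel

/-- The spatial domain `Ω = ℝ^d` with its Euclidean norm and Lebesgue measure. -/
abbrev Dom (d : ℕ) : Type := EuclideanSpace ℝ (Fin d)

/-- A real Hilbert space (bundled, so that the spaces `H_0, P_1, H_1, P_2, …` can be constructed
by recursion). -/
structure HilbertSp : Type (u + 1) where
  carrier : Type u
  [normed : NormedAddCommGroup carrier]
  [innerProd : InnerProductSpace ℝ carrier]
  [complete : CompleteSpace carrier]

instance : CoeSort HilbertSp.{u} (Type u) := ⟨HilbertSp.carrier⟩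

attribute [instance] HilbertSp.normed HilbertSp.innerProd HilbertSp.complete

/-! ### Patch extraction -/

section Patch

variable {d : ℕ}

/-- The patch space `L²(S, H)`, where `S` carries the normalized uniform measure, i.e. Lebesgue
measure conditioned on `S`. -/
def patchSpace (S : Set (Dom d)) (H : HilbertSp.{u}) : HilbertSp.{u} :=
  ⟨Lp H 2 (ProbabilityTheory.cond (volume : Measure (Dom d)) S)⟩

open scoped Classical in
/-- The patch extraction operator: `P x (u)` is the class of `v ↦ x (u + v)` in `L²(S, H)`.
The `else` branch is never used for `x ∈ L²(Ω, H)` and `S` compact of positive measure. -/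
def patchExtraction (S : Set (Dom d)) {H : HilbertSp.{u}} (x : Dom d → H) :
    Dom d → patchSpace S H :=
  fun u =>
    if h : MemLp (fun v => x (u + v)) 2 (ProbabilityTheory.cond (volume : Measure (Dom d)) S)
    then h.toLp (fun v => x (u + v))
    else (0 : Lp H 2 (ProbabilityTheory.cond (volume : Measure (Dom d)) S))

end Patch

/-! ### Homogeneous dot-product kernels and their reproducing kernel Hilbert spaces -/

/-- A function `κ(u) = ∑ b_j u^j` on `[-1, 1]` with `b_j ≥ 0`, `∑ b_j` and `∑ j b_j` convergent,
`κ(1) = 1` and `κ'(1) = 1` (the derivative at the endpoint `1` of the interval). -/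
structure DotProductFun where
  coeff : ℕ → ℝ
  coeff_nonneg : ∀ j, 0 ≤ coeff j
  summable_coeff : Summable coeff
  summable_mul_coeff : Summable fun j : ℕ => (j : ℝ) * coeff j
  map_one : ∑' j, coeff j * (1 : ℝ) ^ j = 1
  deriv_one : HasDerivWithinAt (fun t : ℝ => ∑' j, coeff j * t ^ j) 1 (Set.Icc (-1) 1) 1

/-- The function `κ` itself. -/
def DotProductFun.eval (κ : DotProductFun) (t : ℝ) : ℝ := ∑' j, κ.coeff j * t ^ j

section Kernel

variable (κ : DotProductFun) (P : HilbertSp.{u})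

/-- The kernel `K(z, z') = ‖z‖ ‖z'‖ κ(⟨z, z'⟩ / (‖z‖ ‖z'‖))`; it vanishes if `z = 0` or `z' = 0`,
because of the factor `‖z‖ ‖z'‖`. -/
def dotKernel (z z' : P) : ℝ :=
  ‖z‖ * ‖z'‖ * κ.eval (⟪z, z'⟫_ℝ / (‖z‖ * ‖z'‖))

/-- The kernel, each value being regarded as the corresponding multiplication operator on `ℝ`. -/
def dotKernelMatrix : Matrix P P (ℝ →L[ℝ] ℝ) :=
  Matrix.of fun z z' => dotKernel κ P z z' • (1 : ℝ →L[ℝ] ℝ)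

theorem dotKernel_symm (z z' : P) : dotKernel κ P z z' = dotKernel κ P z' z := by
  simp only [dotKernel, real_inner_comm z z', mul_comm ‖z‖]

theorem gram_pow_nonneg (s : Finset P) (c : P → ℝ) (e : P → P) (m : ℕ) :
    0 ≤ ∑ x ∈ s, ∑ y ∈ s, c x * c y * ⟪e x, e y⟫_ℝ ^ m := by
  have key : ∀ m : ℕ, (Matrix.of fun x y : s => ⟪e x, e y⟫_ℝ ^ m).PosSemidef := by
    intro m
    induction m with
    | zero =>
      have h := Matrix.posSemidef_gram ℝ (fun _ : s => (1 : ℝ))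
      have e : (Matrix.of fun x y : s => ⟪e x, e y⟫_ℝ ^ 0) = Matrix.gram ℝ fun _ : s => (1 : ℝ) := by
        ext x y
        simp
      rw [e]
      exact h
    | succ m ih =>
      have h := Matrix.posSemidef_gram ℝ (fun x : s => e x)
      have e : (Matrix.of fun x y : s => ⟪e x, e y⟫_ℝ ^ (m + 1)) =
          (Matrix.of fun x y : s => ⟪e x, e y⟫_ℝ ^ m).hadamard (Matrix.gram ℝ fun x : s => e x) := by
        ext x y
        simp [pow_succ]
      rw [e]
      exact ih.hadamard h
  have h := (key m).dotProduct_mulVec_nonneg (fun x : s => c x)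
  rw [← Finset.sum_coe_sort s]
  refine h.trans_eq ?_
  simp only [dotProduct, Matrix.mulVec, Finset.mul_sum]
  refine Finset.sum_congr rfl fun x _ => ?_
  rw [← Finset.sum_coe_sort s]
  refine Finset.sum_congr rfl fun y _ => ?_
  simp
  ring

theorem dotKernel_sum_nonneg (s : Finset P) (c : P → ℝ) :
    0 ≤ ∑ x ∈ s, ∑ y ∈ s, c x * c y * dotKernel κ P x y := by
  have hsum : ∀ x y : P, HasSum
      (fun m => κ.coeff m * ((c x * ‖x‖) * (c y * ‖y‖) *
        ⟪(‖x‖⁻¹ • x : P), (‖y‖⁻¹ • y : P)⟫_ℝ ^ m))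
      (c x * c y * dotKernel κ P x y) := by
    intro x y
    have hin : ⟪(‖x‖⁻¹ • x : P), (‖y‖⁻¹ • y : P)⟫_ℝ = ⟪x, y⟫_ℝ / (‖x‖ * ‖y‖) := by
      rw [real_inner_smul_left, real_inner_smul_right]
      ring
    have hle : |⟪x, y⟫_ℝ / (‖x‖ * ‖y‖)| ≤ 1 := abs_real_inner_div_norm_mul_norm_le_one x y
    have hs : Summable fun m => κ.coeff m * (⟪x, y⟫_ℝ / (‖x‖ * ‖y‖)) ^ m := by
      refine Summable.of_norm_bounded κ.summable_coeff fun m => ?_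
      rw [norm_mul, norm_pow, Real.norm_of_nonneg (κ.coeff_nonneg m)]
      exact mul_le_of_le_one_right (κ.coeff_nonneg m) (pow_le_one₀ (norm_nonneg _) hle)
    have h2 := hs.hasSum.mul_left ((c x * ‖x‖) * (c y * ‖y‖))
    rw [hin]
    have e : c x * c y * dotKernel κ P x y = (c x * ‖x‖) * (c y * ‖y‖) *
        ∑' m, κ.coeff m * (⟪x, y⟫_ℝ / (‖x‖ * ‖y‖)) ^ m := by
      simp only [dotKernel, DotProductFun.eval]
      ring
    rw [e]
    refine h2.congr_fun fun m => ?_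
    ring
  have htot := hasSum_sum (s := s) fun x _ => hasSum_sum (s := s) fun y _ => hsum x y
  refine htot.nonneg fun m => ?_
  have h := gram_pow_nonneg P s (fun x => c x * ‖x‖) (fun x => ‖x‖⁻¹ • x) m
  simp only [← Finset.mul_sum]
  exact mul_nonneg (κ.coeff_nonneg m) h

/-- The homogeneous dot-product kernel is positive definite (in the sense of kernels). -/
theorem dotKernelMatrix_posSemidef : (dotKernelMatrix κ P).PosSemidef := by
  have tfae := (RKHS.posSemidef_tfae (K := dotKernelMatrix κ P)).out 0 2
  refine tfae.mpr ⟨?_, fun c => ?_⟩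
  · ext z z'
    simp [dotKernelMatrix, dotKernel_symm κ P z z', Matrix.conjTranspose_apply]
  · have h := dotKernel_sum_nonneg κ P c.support c
    refine h.trans_eq ?_
    simp only [Finsupp.sum, dotKernelMatrix, RCLike.re_to_real]
    refine Finset.sum_congr rfl fun x _ => Finset.sum_congr rfl fun y _ => ?_
    simp [dotKernel_symm κ P y x]
    ring

instance : Fact (dotKernelMatrix κ P).PosSemidef := ⟨dotKernelMatrix_posSemidef κ P⟩

/-- The reproducing kernel Hilbert space of the kernel `K`. -/
def rkhs : HilbertSp.{u} := ⟨RKHS.OfKernel (dotKernelMatrix κ P)⟩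

/-- The kernel mapping `φ : P → H` into the reproducing kernel Hilbert space, `φ(z) = K(·, z)`. -/
def kernelMap (z : P) : rkhs κ P :=
  RKHS.kerFun (RKHS.OfKernel (dotKernelMatrix κ P)) z (1 : ℝ)

end Kernel

/-- The kernel mapping operator `M`, which applies `φ` pointwise. -/
def kernelMapping {d : ℕ} (κ : DotProductFun) {P : HilbertSp.{u}} (z : Dom d → P) :
    Dom d → rkhs κ P :=
  fun u => kernelMap κ P (z u)

/-! ### Gaussian pooling -/

/-- The Gaussian `h(u) = (2π)^(-d/2) exp(-|u|²/2)` on `ℝ^d`. -/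
def gauss (d : ℕ) (u : Dom d) : ℝ :=
  (2 * Real.pi) ^ (-(d : ℝ) / 2) * Real.exp (-‖u‖ ^ 2 / 2)

/-- The rescaled Gaussian `h_σ(u) = σ^(-d) h(u / σ)`. -/
def gaussScaled (d : ℕ) (σ : ℝ) (u : Dom d) : ℝ :=
  (σ ^ d)⁻¹ * gauss d (σ⁻¹ • u)

/-- The pooling operator `A_σ`: convolution with `h_σ` (a Bochner integral). -/
def pooling {d : ℕ} (σ : ℝ) {H : HilbertSp.{u}} (y : Dom d → H) : Dom d → H :=
  fun u => ∫ v, gaussScaled d σ (u - v) • y v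

/-! ### The multilayer representation -/

/-- The parameters of the multilayer construction on `ℝ^d`: `patch k`, `dotFun k` are the patch
shape and the function `κ` of layer `k + 1` (they lead from layer `k` to layer `k + 1`), and
`scale k` is the pooling scale of layer `k`, `scale 0` being that of the initial pooling. -/
structure Architecture (d : ℕ) where
  patch : ℕ → Set (Dom d)
  isCompact_patch : ∀ k, IsCompact (patch k)
  volume_patch_pos : ∀ k, 0 < volume (patch k)
  dotFun : ℕ → DotProductFun
  scale : ℕ → ℝ
  scale_pos : ∀ k, 0 < scale k

namespace Architecture

variable {d : ℕ} (N : Architecture d) (H₀ : HilbertSp.{u})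

/-- The Hilbert spaces `H_k`: `H_{k+1}` is the RKHS of the kernel `K_{k+1}` on the patch space
`P_{k+1} = L²(S_{k+1}, H_k)`. -/
def featureSpace : ℕ → HilbertSp.{u}
  | 0 => H₀
  | k + 1 => rkhs (N.dotFun k) (patchSpace (N.patch k) (featureSpace k))

/-- The representation `Φ_n(x) = A_n M_n P_n ⋯ A_1 M_1 P_1 A_0 x`. -/
def repr : (n : ℕ) → (Dom d → H₀) → Dom d → N.featureSpace H₀ n
  | 0, x => pooling (N.scale 0) x
  | k + 1, x =>
      pooling (N.scale (k + 1))
        (kernelMapping (N.dotFun k) (patchExtraction (N.patch k) (repr k x)))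

end Architecture

/-! ### Deformations -/

section Deformation

variable {d : ℕ}

/-- The deformation operator `L_τ x (u) = x (u - τ(u))`. -/
def deform (τ : Dom d → Dom d) {H : HilbertSp.{u}} (x : Dom d → H) : Dom d → H :=
  fun u => x (u - τ u)

/-- `‖τ‖_∞ = sup_u |τ(u)|`, as an element of `[0, ∞]`. -/
def supNorm (τ : Dom d → Dom d) : ℝ≥0∞ := ⨆ u, ‖τ u‖ₑ

/-- `‖∇τ‖_∞ = sup_u ‖∇τ(u)‖` (operator norm of the Jacobian), as an element of `[0, ∞]`. -/
def supGradNorm (τ : Dom d → Dom d) : ℝ≥0∞ := ⨆ u, ‖fderiv ℝ τ u‖ₑ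

end Deformation

/-- The constant `C₂ = 2^d ‖∇h‖₁`, with `h` the standard Gaussian on `ℝ^d`. -/
def transConst (d : ℕ) : ℝ := 2 ^ d * ∫ u : Dom d, ‖gradient (gauss d) u‖

end ConvKernel

end

noncomputable section

namespace ConvKernel

open Filter Topology

/-! Write `L` for the deformation and `y_k(x)` for the signal at layer `k` before its pooling `A_k`,
so that `Φ_n(x) = A_n y_n(x)`. The maps `M_k` act pointwise and hence commute with `L`; they
preserve norms and are 1-Lipschitz, because `κ_k(t) ≥ t` (`norm_kernelMap_sub_le`). Patch extraction
averages squared `L²` norms over shifts `c` in the patch. So only the commutator of `L` with pooling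
followed by a shift `c`, `|c| ≤ κσ`, has to be estimated.

The change of variables `v ↦ v - τ(v)` turns this commutator into an integral operator applied to `L
y`, with kernel `h_σ(a) - |det(1 - ∇τ(v))| h_σ(a - (τ(u) - τ(v)))`, where `a = u + c - v`. The
Jacobian is within `O(ε)` of `1`, with `ε = ‖∇τ‖_∞`, and the displacement is at most `ε(|a| + κσ)`.
A wider Gaussian absorbs the polynomial growth, so the kernel is at most `C ε h_{4σ}(a)`, and
Schur's test gives an `L²` bound of order `ε` (`exists_eLpNorm_pooling_deform_sub_le`).

By induction `y_n(Lx)` differs from `L y_n(x)` by at most `n C ε ‖x‖`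
(`eLpNorm_unpooled_deform_sub_le`), and the last pooling adds one more commutator. What remains, `L
A_n y_n - A_n y_n`, is handled by integrating `∇h_σ` along the segment from `u` to `u - τ(u)` and
applying Schur's test again (`eLpNorm_pooling_comp_id_sub_sub_le`); this produces `C₂ ‖τ‖_∞ / σ_n`.
-/

/-! ### Power series with nonnegative coefficients: `κ(t) ≥ t`. -/

theorem DotProductFun.summable_coeff_mul_pow (κ : DotProductFun) {t : ℝ} (ht : |t| ≤ 1) :
    Summable fun j => κ.coeff j * t ^ j := by
  refine Summable.of_norm_bounded κ.summable_coeff fun m => ?_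
  rw [norm_mul, norm_pow, Real.norm_of_nonneg (κ.coeff_nonneg m)]
  exact mul_le_of_le_one_right (κ.coeff_nonneg m) (pow_le_one₀ (norm_nonneg _) ht)

theorem DotProductFun.tsum_coeff (κ : DotProductFun) : ∑' j, κ.coeff j = 1 := by
  simpa using κ.map_one

theorem DotProductFun.eval_one (κ : DotProductFun) : κ.eval 1 = 1 := κ.map_one

/-- All terms of the difference quotient of `κ` at `1` are nonnegative for `t < 1`, so finite
partial sums have smaller slopes than `κ`; let `t → 1` from the left. Only this inequality is
needed, not termwise differentiation of the whole series. -/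
theorem DotProductFun.tsum_mul_coeff_le_one (κ : DotProductFun) :
    ∑' j : ℕ, (j : ℝ) * κ.coeff j ≤ 1 := by
  refine κ.summable_mul_coeff.tsum_le_of_sum_le fun s => ?_
  have hf : HasDerivWithinAt (fun t : ℝ => ∑' j, κ.coeff j * t ^ j) 1 (Set.Ico (-1) 1) 1 :=
    κ.deriv_one.mono Set.Ico_subset_Icc_self
  have hg : HasDerivWithinAt (fun t : ℝ => ∑ j ∈ s, κ.coeff j * t ^ j)
      (∑ j ∈ s, (j : ℝ) * κ.coeff j) (Set.Ico (-1) 1) 1 := by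
    refine HasDerivWithinAt.fun_sum fun j _ => ?_
    have h := ((hasDerivAt_pow j (1 : ℝ)).const_mul (κ.coeff j)).hasDerivWithinAt
      (s := Set.Ico (-1) 1)
    simpa [mul_comm] using h
  rw [hasDerivWithinAt_iff_tendsto_slope' (by simp)] at hf hg
  have : (𝓝[Set.Ico (-1 : ℝ) 1] 1).NeBot := by
    rw [nhdsWithin_Ico_eq_nhdsLT (by norm_num)]
    infer_instance
  refine le_of_tendsto_of_tendsto hg hf ?_
  filter_upwards [self_mem_nhdsWithin] with t ht
  have ht1 : |t| ≤ 1 := abs_le.2 ⟨ht.1, ht.2.le⟩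
  have hlt : t - 1 < 0 := by linarith [ht.2]
  simp only [slope_def_field]
  -- The denominator `t - 1` is negative, which reverses the comparison of the numerators.
  refine (div_le_div_right_of_neg hlt).2 ?_
  have hs := κ.summable_coeff_mul_pow ht1
  have h1 : Summable fun j => κ.coeff j * (1 : ℝ) ^ j := by simpa using κ.summable_coeff
  rw [← hs.tsum_sub h1, ← Finset.sum_sub_distrib, ← neg_le_neg_iff, ← tsum_neg,
    ← Finset.sum_neg_distrib]
  refine (hs.sub h1).neg.sum_le_tsum s fun j _ => ?_
  have : t ^ j ≤ 1 := (le_abs_self _).trans (by rw [abs_pow]; exact pow_le_one₀ (abs_nonneg _) ht1)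
  rw [one_pow]
  nlinarith [κ.coeff_nonneg j]

/-- Bernoulli's inequality `t^j ≥ 1 + j(t - 1)` in each term gives `κ(t) ≥ 1 + (t - 1) ∑ j b_j`, and
`∑ j b_j ≤ 1` while `t - 1 ≤ 0`. -/
theorem DotProductFun.le_eval (κ : DotProductFun) {t : ℝ} (ht : |t| ≤ 1) : t ≤ κ.eval t := by
  have h1 : ∑' j, (κ.coeff j + (t - 1) * ((j : ℝ) * κ.coeff j)) ≤ κ.eval t := by
    refine (κ.summable_coeff.add (κ.summable_mul_coeff.mul_left _)).tsum_le_tsum (fun j => ?_)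
      (κ.summable_coeff_mul_pow ht)
    have h := one_add_mul_le_pow (a := t - 1) (by linarith [(abs_le.1 ht).1]) j
    rw [add_sub_cancel] at h
    nlinarith [κ.coeff_nonneg j]
  rw [κ.summable_coeff.tsum_add (κ.summable_mul_coeff.mul_left _), tsum_mul_left,
    κ.tsum_coeff] at h1
  nlinarith [mul_nonneg (sub_nonneg.2 κ.tsum_mul_coeff_le_one) (sub_nonneg.2 (abs_le.1 ht).2)]

/-! ### The kernel mapping preserves norms and is nonexpansive. -/

section KernelMap

variable (κ : DotProductFun) (P : HilbertSp.{u})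

theorem inner_kernelMap (z z' : P) :
    ⟪kernelMap κ P z, kernelMap κ P z'⟫_ℝ = dotKernel κ P z z' := by
  have h := RKHS.kernel_inner (𝕜 := ℝ) (H := RKHS.OfKernel (dotKernelMatrix κ P)) z' z (1 : ℝ) 1
  rw [RKHS.OfKernel.kernel_ofKernel] at h
  rw [dotKernel_symm]
  refine Eq.trans ?_ (h.symm.trans ?_)
  · rfl
  · simp [dotKernelMatrix]

theorem norm_kernelMap (z : P) : ‖kernelMap κ P z‖ = ‖z‖ := by
  have h : ‖kernelMap κ P z‖ ^ 2 = ‖z‖ ^ 2 := by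
    rw [← real_inner_self_eq_norm_sq, inner_kernelMap, dotKernel, real_inner_self_eq_norm_sq]
    rcases eq_or_ne ‖z‖ 0 with h0 | h0
    · simp [h0]
    · rw [← sq, div_self (pow_ne_zero 2 h0), κ.eval_one, mul_one]
  exact (sq_eq_sq₀ (norm_nonneg _) (norm_nonneg _)).1 h

/-- Since norms are preserved, expanding both squares reduces the claim to `⟪z, z'⟫ ≤ K(z, z')`,
which is `t ≤ κ(t)` at the cosine of the angle. -/
theorem norm_kernelMap_sub_le (z z' : P) :
    ‖kernelMap κ P z - kernelMap κ P z'‖ ≤ ‖z - z'‖ := by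
  refine le_of_sq_le_sq ?_ (norm_nonneg _)
  rw [norm_sub_sq_real, norm_sub_sq_real, norm_kernelMap, norm_kernelMap, inner_kernelMap,
    dotKernel]
  have h := κ.le_eval (abs_real_inner_div_norm_mul_norm_le_one z z')
  have h2 := mul_le_mul_of_nonneg_left h (mul_nonneg (norm_nonneg z) (norm_nonneg z'))
  have h3 : ‖z‖ * ‖z'‖ * (⟪z, z'⟫_ℝ / (‖z‖ * ‖z'‖)) = ⟪z, z'⟫_ℝ := by
    -- If a norm vanishes, the quotient is `0` by convention, and the inner product is `0` by
    -- Cauchy–Schwarz.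
    rcases eq_or_ne (‖z‖ * ‖z'‖) 0 with h0 | h0
    · have := abs_real_inner_le_norm z z'
      rw [h0] at this ⊢
      rw [zero_mul, abs_nonpos_iff.1 this]
    · rw [mul_div_cancel₀ _ h0]
  linarith

theorem continuous_kernelMap : Continuous (kernelMap κ P) :=
  (LipschitzWith.of_dist_le_mul (K := 1) fun z z' => by
    simpa [dist_eq_norm] using norm_kernelMap_sub_le κ P z z').continuous

end KernelMap

/-! ### Squared `L²` norms and Schur's test. -/

section L2

variable {α : Type*} {m : MeasurableSpace α} {μ : Measure α}

theorem eLpNorm_two_sq {E : Type*} [ENorm E] (f : α → E) :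
    eLpNorm f 2 μ ^ 2 = ∫⁻ a, ‖f a‖ₑ ^ 2 ∂μ := by
  have h := eLpNorm_nnreal_pow_eq_lintegral (μ := μ) (f := f) (p := 2) two_ne_zero
  simpa using h

theorem eLpNorm_two_le_iff {E : Type*} [ENorm E] {f : α → E} {C : ℝ≥0∞} :
    eLpNorm f 2 μ ≤ C ↔ ∫⁻ a, ‖f a‖ₑ ^ 2 ∂μ ≤ C ^ 2 := by
  rw [← eLpNorm_two_sq, ENNReal.pow_le_pow_left_iff two_ne_zero]

/-- The Cauchy–Schwarz inequality for a nonnegative weight. -/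
theorem sq_lintegral_mul_le {w f : α → ℝ≥0∞} (hw : AEMeasurable w μ) (hf : AEMeasurable f μ) :
    (∫⁻ a, w a * f a ∂μ) ^ 2 ≤ (∫⁻ a, w a ∂μ) * ∫⁻ a, w a * f a ^ 2 ∂μ := by
  -- Split `w f` as `w^{1/2} · (w^{1/2} f)`.
  have h := ENNReal.lintegral_mul_le_Lp_mul_Lq μ Real.HolderConjugate.two_two
    (f := fun a => w a ^ (1 / 2 : ℝ)) (g := fun a => w a ^ (1 / 2 : ℝ) * f a)
    (hw.pow_const _) ((hw.pow_const _).mul hf)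
  have hs : ∀ x : ℝ≥0∞, x ^ (1 / 2 : ℝ) * x ^ (1 / 2 : ℝ) = x := fun x => by
    rw [← ENNReal.rpow_add_of_nonneg _ _ (by norm_num) (by norm_num)]
    norm_num
  have hs2 : ∀ x : ℝ≥0∞, (x ^ (1 / 2 : ℝ)) ^ 2 = x := fun x => by rw [sq, hs]
  simp only [Pi.mul_apply, ← mul_assoc, hs, ENNReal.rpow_two, mul_pow, hs2] at h
  refine (ENNReal.pow_le_pow_left h).trans_eq ?_
  rw [mul_pow, hs2, hs2]

/-- **Schur's test** for the boundedness of an integral operator on `L²`. -/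
theorem lintegral_sq_lintegral_mul_le {β : Type*} {m' : MeasurableSpace β} {ν : Measure β}
    [SFinite μ] [SFinite ν] {K : α → β → ℝ≥0∞} (hK : Measurable (Function.uncurry K))
    {f : β → ℝ≥0∞} (hf : AEMeasurable f ν) {M : ℝ≥0∞} (h1 : ∀ a, ∫⁻ b, K a b ∂ν ≤ M)
    (h2 : ∀ b, ∫⁻ a, K a b ∂μ ≤ M) :
    ∫⁻ a, (∫⁻ b, K a b * f b ∂ν) ^ 2 ∂μ ≤ M ^ 2 * ∫⁻ b, f b ^ 2 ∂ν := by
  calc ∫⁻ a, (∫⁻ b, K a b * f b ∂ν) ^ 2 ∂μ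
      ≤ ∫⁻ a, ∫⁻ b, M * (K a b * f b ^ 2) ∂ν ∂μ := by
        refine lintegral_mono fun a => ?_
        have hKa : Measurable (K a) := hK.of_uncurry_left
        refine (sq_lintegral_mul_le hKa.aemeasurable hf).trans ?_
        rw [lintegral_const_mul'' (f := fun b => K a b * f b ^ 2) _
          (hKa.aemeasurable.mul (hf.pow_const 2))]
        exact mul_le_mul_left (h1 a) _
    _ = ∫⁻ b, ∫⁻ a, M * (K a b * f b ^ 2) ∂μ ∂ν := by
        refine lintegral_lintegral_swap ?_
        exact (hK.aemeasurable.mul (hf.comp_snd.pow_const 2)).const_mul M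
    _ ≤ ∫⁻ b, M ^ 2 * f b ^ 2 ∂ν := by
        refine lintegral_mono fun b => ?_
        have hKb : Measurable fun a => K a b := hK.of_uncurry_right
        simp only [← mul_assoc]
        rw [lintegral_mul_const _ (hKb.const_mul _), lintegral_const_mul _ hKb, sq M]
        exact mul_le_mul_left (mul_le_mul_right (h2 b) _) _
    _ = M ^ 2 * ∫⁻ b, f b ^ 2 ∂ν := lintegral_const_mul'' _ (hf.pow_const 2)

end L2

/-! ### Determinants of perturbations of the identity. -/

section Det

variable {E : Type*} [NormedAddCommGroup E] [NormedSpace ℝ E] [FiniteDimensional ℝ E]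

/-- `|det|` is the volume scaling factor, and `1 - A` maps the unit ball into the ball of radius `1
+ ε`. The lower bound below is dual: the image contains the ball of radius `1 - ε`. -/
theorem abs_det_one_sub_le {A : E →L[ℝ] E} {ε : ℝ} (hA : ‖A‖ ≤ ε) :
    |(1 - A).det| ≤ (1 + ε) ^ Module.finrank ℝ E := by
  borelize E
  let μ : Measure E := Measure.addHaar
  have hε : 0 ≤ ε := (norm_nonneg _).trans hA
  have h := Measure.addHaar_image_continuousLinearMap μ (1 - A) (Metric.closedBall 0 1)
  have hsub : (1 - A : E →L[ℝ] E) '' Metric.closedBall 0 1 ⊆ Metric.closedBall 0 (1 + ε) := by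
    rintro _ ⟨x, hx, rfl⟩
    rw [mem_closedBall_zero_iff] at hx ⊢
    have h1 : ‖A x‖ ≤ ε := by
      simpa using (A.le_of_opNorm_le hA x).trans (mul_le_mul_of_nonneg_left hx hε)
    refine (norm_sub_le x (A x)).trans (add_le_add hx h1)
  have h2 := measure_mono (μ := μ) hsub
  rw [h, Measure.addHaar_closedBall' μ 0 (r := 1 + ε) (by positivity)] at h2
  rwa [ENNReal.mul_le_mul_iff_left (Metric.measure_closedBall_pos μ _ one_pos).ne'
    measure_closedBall_lt_top.ne, ENNReal.ofReal_le_ofReal_iff (by positivity)] at h2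

theorem le_abs_det_one_sub {A : E →L[ℝ] E} {ε : ℝ} (hA : ‖A‖ ≤ ε) (hε1 : ε < 1) :
    (1 - ε) ^ Module.finrank ℝ E ≤ |(1 - A).det| := by
  borelize E
  let μ : Measure E := Measure.addHaar
  have hε : 0 ≤ ε := (norm_nonneg _).trans hA
  have h := Measure.addHaar_image_continuousLinearMap μ (1 - A) (Metric.closedBall 0 1)
  have hlow : ∀ x, (1 - ε) * ‖x‖ ≤ ‖(1 - A) x‖ := fun x => by
    have h1 := A.le_of_opNorm_le hA x
    have h2 : ‖x‖ - ‖A x‖ ≤ ‖(1 - A) x‖ := norm_sub_norm_le x (A x)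
    linarith
  have hinj : Function.Injective (1 - A : E →L[ℝ] E).toLinearMap := by
    refine (injective_iff_map_eq_zero _).2 fun x hx => ?_
    have h1 := hlow x
    rw [show (1 - A) x = 0 from hx, norm_zero] at h1
    exact norm_le_zero_iff.1 (nonpos_of_mul_nonpos_right h1 (by linarith))
  have hsub : Metric.closedBall 0 (1 - ε) ⊆ (1 - A : E →L[ℝ] E) '' Metric.closedBall 0 1 := by
    intro y hy
    obtain ⟨x, rfl⟩ := LinearMap.surjective_of_injective hinj y
    refine ⟨x, ?_, rfl⟩
    rw [mem_closedBall_zero_iff] at hy ⊢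
    have h1 := (hlow x).trans hy
    exact le_of_mul_le_mul_left (by simpa using h1) (by linarith : 0 < 1 - ε)
  have h2 := measure_mono (μ := μ) hsub
  rw [h, Measure.addHaar_closedBall' μ 0 (r := 1 - ε) (by linarith)] at h2
  rwa [ENNReal.mul_le_mul_iff_left (Metric.measure_closedBall_pos μ _ one_pos).ne'
    measure_closedBall_lt_top.ne, ENNReal.ofReal_le_ofReal_iff (abs_nonneg _)] at h2

theorem abs_abs_det_one_sub_sub_one_le {A : E →L[ℝ] E} {ε : ℝ} (hA : ‖A‖ ≤ ε) (hε1 : ε < 1) :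
    |(|(1 - A).det| - 1)| ≤ Module.finrank ℝ E * 2 ^ Module.finrank ℝ E * ε := by
  set n := Module.finrank ℝ E
  have hε : 0 ≤ ε := (norm_nonneg _).trans hA
  have h1 := abs_det_one_sub_le hA
  have h2 := le_abs_det_one_sub hA hε1
  have h3 : 1 - n * ε ≤ (1 - ε) ^ n := by
    have := one_add_mul_le_pow (a := -ε) (by linarith) n
    simpa [sub_eq_add_neg] using this
  have h4 : (1 + ε) ^ n - 1 ≤ n * 2 ^ n * ε := by
    -- Bernoulli applied to `(1 + ε)⁻¹ = 1 - ε/(1 + ε)` yields an upper bound on `(1 + ε)^n - 1`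
    -- that is linear in `ε`.
    have := one_add_mul_le_pow (a := -(ε / (1 + ε)))
      (by rw [neg_le_neg_iff, div_le_iff₀ (by linarith)]; linarith) n
    have he : 1 + -(ε / (1 + ε)) = (1 + ε)⁻¹ := by field_simp; ring
    rw [he, inv_pow] at this
    have hp : 0 < (1 + ε) ^ n := by positivity
    have h5 := mul_le_mul_of_nonneg_left this hp.le
    rw [mul_inv_cancel₀ hp.ne'] at h5
    have h6 : ε / (1 + ε) ≤ ε := div_le_self hε (by linarith)
    have h7 : (1 + ε) ^ n ≤ 2 ^ n := by gcongr; linarith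
    have h8 : (1 + ε) ^ n * (n * (ε / (1 + ε))) ≤ 2 ^ n * (n * ε) := by gcongr
    nlinarith
  have h5 : n * ε ≤ n * 2 ^ n * ε := by
    have : (1 : ℝ) ≤ 2 ^ n := one_le_pow₀ (by norm_num)
    have h0 : 0 ≤ n * ε := by positivity
    nlinarith
  rw [abs_le]
  constructor <;> linarith

end Det

/-! ### The change of variables `u ↦ u - τ(u)` and the deformation operator on `L²`. -/

section Deformation

variable {d : ℕ} {τ : Dom d → Dom d} {ε : ℝ}

theorem norm_sub_le_of_fderiv_le (hτ : ContDiff ℝ 1 τ) (hε : ∀ u, ‖fderiv ℝ τ u‖ ≤ ε)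
    (u v : Dom d) : ‖τ u - τ v‖ ≤ ε * ‖u - v‖ :=
  Convex.norm_image_sub_le_of_norm_fderiv_le (𝕜 := ℝ)
    (fun x _ => (hτ.differentiable one_ne_zero) x) (fun x _ => hε x) convex_univ
    (Set.mem_univ v) (Set.mem_univ u)

theorem hasFDerivAt_id_sub (hτ : ContDiff ℝ 1 τ) (u : Dom d) :
    HasFDerivAt (fun u => u - τ u) (1 - fderiv ℝ τ u) u :=
  (hasFDerivAt_id u).sub ((hτ.differentiable one_ne_zero) u).hasFDerivAt

/-- `τ` is a contraction, so the map is a global Lipschitz-small perturbation of the identity. The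
trivial space `d = 0` is separated because the identity there does not have norm `1`. -/
theorem bijective_id_sub (hτ : ContDiff ℝ 1 τ) (hε : ∀ u, ‖fderiv ℝ τ u‖ ≤ ε) (hε1 : ε < 1) :
    Function.Bijective fun u => u - τ u := by
  have hε0 : 0 ≤ ε := (norm_nonneg _).trans (hε 0)
  have hf : ApproximatesLinearOn (fun u => u - τ u)
      ((ContinuousLinearEquiv.refl ℝ (Dom d) : Dom d ≃L[ℝ] Dom d) : Dom d →L[ℝ] Dom d)
      Set.univ ⟨ε, hε0⟩ := by
    intro u _ v _
    have h := norm_sub_le_of_fderiv_le hτ hε v u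
    rw [norm_sub_rev u v]
    have e : (u - τ u) - (v - τ v) - (u - v) = τ v - τ u := by abel
    exact (congrArg norm e).trans_le h
  have hc : Subsingleton (Dom d) ∨ (⟨ε, hε0⟩ : NNReal) <
      ‖((ContinuousLinearEquiv.refl ℝ (Dom d)).symm : Dom d →L[ℝ] Dom d)‖₊⁻¹ := by
    rcases subsingleton_or_nontrivial (Dom d) with h | h
    · exact Or.inl h
    · right
      have : ‖((ContinuousLinearEquiv.refl ℝ (Dom d)).symm : Dom d →L[ℝ] Dom d)‖₊ = 1 := by
        simp
      rw [this, inv_one]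
      exact_mod_cast hε1
  exact ⟨Set.injOn_univ.1 (hf.injOn hc), hf.surjective hc⟩

theorem lintegral_comp_id_sub (hτ : ContDiff ℝ 1 τ) (hε : ∀ u, ‖fderiv ℝ τ u‖ ≤ ε) (hε1 : ε < 1)
    (f : Dom d → ℝ≥0∞) :
    ∫⁻ u, f u = ∫⁻ u, ENNReal.ofReal |(1 - fderiv ℝ τ u).det| * f (u - τ u) := by
  have hb := bijective_id_sub hτ hε hε1
  have h := lintegral_image_eq_lintegral_abs_det_fderiv_mul volume MeasurableSet.univ
    (fun u _ => (hasFDerivAt_id_sub hτ u).hasFDerivWithinAt) hb.1.injOn f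
  rwa [Set.image_univ, hb.2.range_eq, setLIntegral_univ, setLIntegral_univ] at h

theorem integral_comp_id_sub {E : Type*} [NormedAddCommGroup E] [NormedSpace ℝ E]
    (hτ : ContDiff ℝ 1 τ) (hε : ∀ u, ‖fderiv ℝ τ u‖ ≤ ε) (hε1 : ε < 1) (f : Dom d → E) :
    ∫ u, f u = ∫ u, |(1 - fderiv ℝ τ u).det| • f (u - τ u) := by
  have hb := bijective_id_sub hτ hε hε1
  have h := integral_image_eq_integral_abs_det_fderiv_smul volume MeasurableSet.univ
    (fun u _ => (hasFDerivAt_id_sub hτ u).hasFDerivWithinAt) hb.1.injOn f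
  rwa [Set.image_univ, hb.2.range_eq, setIntegral_univ, setIntegral_univ] at h

theorem integrable_comp_id_sub_iff {E : Type*} [NormedAddCommGroup E] [NormedSpace ℝ E]
    (hτ : ContDiff ℝ 1 τ) (hε : ∀ u, ‖fderiv ℝ τ u‖ ≤ ε) (hε1 : ε < 1) (f : Dom d → E) :
    Integrable f ↔ Integrable fun u => |(1 - fderiv ℝ τ u).det| • f (u - τ u) := by
  have hb := bijective_id_sub hτ hε hε1
  have h := integrableOn_image_iff_integrableOn_abs_det_fderiv_smul volume MeasurableSet.univ
    (fun u _ => (hasFDerivAt_id_sub hτ u).hasFDerivWithinAt) hb.1.injOn f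
  rwa [Set.image_univ, hb.2.range_eq, integrableOn_univ, integrableOn_univ] at h

/-- The Jacobian is at least `(1 - ε)^d ≥ 2^{-d}`. This is the source of every factor `2^d` from a
deformation, including the one in `C₂`. -/
theorem lintegral_comp_id_sub_le (hτ : ContDiff ℝ 1 τ) (hε : ∀ u, ‖fderiv ℝ τ u‖ ≤ ε)
    (hε2 : ε ≤ 1 / 2) (f : Dom d → ℝ≥0∞) : ∫⁻ u, f (u - τ u) ≤ 2 ^ d * ∫⁻ u, f u := by
  rw [lintegral_comp_id_sub hτ hε (by linarith) f, ← lintegral_const_mul' _ _ (by simp)]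
  refine lintegral_mono fun u => ?_
  rw [← mul_assoc]
  refine le_mul_of_one_le_left' ?_
  have h := le_abs_det_one_sub (hε u) (by linarith)
  rw [finrank_euclideanSpace_fin] at h
  have h2 : (1 / 2 : ℝ) ^ d ≤ (1 - ε) ^ d := by gcongr; linarith
  have h3 : (1 : ℝ) ≤ 2 ^ d * |(1 - fderiv ℝ τ u).det| := by
    calc (1 : ℝ) = 2 ^ d * (1 / 2) ^ d := by rw [← mul_pow]; norm_num
      _ ≤ _ := by gcongr; exact h2.trans h
  have h4 := ENNReal.ofReal_le_ofReal h3
  rwa [ENNReal.ofReal_one, ENNReal.ofReal_mul (by positivity), ENNReal.ofReal_pow (by norm_num),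
    ENNReal.ofReal_ofNat] at h4

theorem quasiMeasurePreserving_id_sub (hτ : ContDiff ℝ 1 τ) (hε : ∀ u, ‖fderiv ℝ τ u‖ ≤ ε)
    (hε2 : ε ≤ 1 / 2) : Measure.QuasiMeasurePreserving fun u => u - τ u := by
  have hm : Measurable fun u => u - τ u := (continuous_id.sub hτ.continuous).measurable
  refine ⟨hm, Measure.AbsolutelyContinuous.mk fun s hs h0 => ?_⟩
  rw [Measure.map_apply hm hs, ← lintegral_indicator_one (hm hs)]
  have h := lintegral_comp_id_sub_le hτ hε hε2 (s.indicator 1)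
  rw [lintegral_indicator_one hs, h0, mul_zero] at h
  exact le_antisymm h zero_le

variable {H : HilbertSp.{u}} {x : Dom d → H}

theorem aestronglyMeasurable_deform (hτ : ContDiff ℝ 1 τ) (hε : ∀ u, ‖fderiv ℝ τ u‖ ≤ ε)
    (hε2 : ε ≤ 1 / 2) (hx : AEStronglyMeasurable x volume) :
    AEStronglyMeasurable (deform τ x) volume :=
  hx.comp_quasiMeasurePreserving (quasiMeasurePreserving_id_sub hτ hε hε2)

theorem eLpNorm_deform_le (hτ : ContDiff ℝ 1 τ) (hε : ∀ u, ‖fderiv ℝ τ u‖ ≤ ε)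
    (hε2 : ε ≤ 1 / 2) : eLpNorm (deform τ x) 2 volume ≤ 2 ^ d * eLpNorm x 2 volume := by
  rw [eLpNorm_two_le_iff, mul_pow, eLpNorm_two_sq]
  refine (lintegral_comp_id_sub_le hτ hε hε2 fun u => ‖x u‖ₑ ^ 2).trans ?_
  -- The sharper factor `2^{d/2}` is given up: `2^d ≤ (2^d)^2`.
  exact mul_le_mul_left (le_self_pow₀ (one_le_pow₀ one_le_two) two_ne_zero) _

theorem memLp_deform (hτ : ContDiff ℝ 1 τ) (hε : ∀ u, ‖fderiv ℝ τ u‖ ≤ ε)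
    (hε2 : ε ≤ 1 / 2) (hx : MemLp x 2 volume) : MemLp (deform τ x) 2 volume :=
  ⟨aestronglyMeasurable_deform hτ hε hε2 hx.1,
    (eLpNorm_deform_le hτ hε hε2).trans_lt (ENNReal.mul_lt_top (by simp) hx.2)⟩

end Deformation

/-! ### Gaussian estimates. -/

section Gaussian

variable {d : ℕ} {σ : ℝ}

theorem gauss_nonneg (u : Dom d) : 0 ≤ gauss d u := by
  unfold gauss; positivity

theorem contDiff_gauss : ContDiff ℝ 1 (gauss d) := by
  unfold gauss
  exact contDiff_const.mul ((contDiff_norm_sq ℝ).neg.div_const 2).exp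

theorem continuous_gauss : Continuous (gauss d) := contDiff_gauss.continuous

theorem integral_gauss : ∫ u : Dom d, gauss d u = 1 := by
  have h := GaussianFourier.integral_rexp_neg_mul_sq_norm (V := Dom d) (b := 1 / 2) (by norm_num)
  have h2 : ∀ u : Dom d, gauss d u =
      (2 * Real.pi) ^ (-(d : ℝ) / 2) * Real.exp (-(1 / 2) * ‖u‖ ^ 2) := fun u => by
    unfold gauss; congr 2; ring
  simp only [h2]
  rw [integral_const_mul, h, finrank_euclideanSpace_fin, show Real.pi / (1 / 2) = 2 * Real.pi by ring,
    ← Real.rpow_add (by positivity)]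
  ring_nf
  simp

theorem integrable_gauss : Integrable (gauss d) := integrable_of_integral_eq_one integral_gauss

theorem gaussScaled_nonneg (hσ : 0 < σ) (u : Dom d) : 0 ≤ gaussScaled d σ u :=
  mul_nonneg (by positivity) (gauss_nonneg _)

theorem continuous_gaussScaled : Continuous (gaussScaled d σ) :=
  continuous_const.mul (continuous_gauss.comp (continuous_const_smul _))

theorem integral_gaussScaled (hσ : 0 < σ) : ∫ u : Dom d, gaussScaled d σ u = 1 := by
  unfold gaussScaled
  rw [integral_const_mul, Measure.integral_comp_smul, integral_gauss, finrank_euclideanSpace_fin,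
    abs_of_pos (by positivity)]
  simp [hσ.ne']

theorem integrable_gaussScaled (hσ : 0 < σ) : Integrable (gaussScaled d σ) :=
  integrable_of_integral_eq_one (integral_gaussScaled hσ)

theorem lintegral_gaussScaled (hσ : 0 < σ) :
    ∫⁻ u : Dom d, ENNReal.ofReal (gaussScaled d σ u) = 1 := by
  rw [← ofReal_integral_eq_lintegral_ofReal (integrable_gaussScaled hσ)
    (Eventually.of_forall (gaussScaled_nonneg hσ)), integral_gaussScaled hσ, ENNReal.ofReal_one]

theorem gauss_le (u : Dom d) : gauss d u ≤ (2 * Real.pi) ^ (-(d : ℝ) / 2) := by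
  refine mul_le_of_le_one_right (by positivity) (Real.exp_le_one_iff.2 ?_)
  have := sq_nonneg ‖u‖
  linarith

theorem memLp_gaussScaled (hσ : 0 < σ) : MemLp (gaussScaled d σ) 2 volume := by
  rw [memLp_two_iff_integrable_sq continuous_gaussScaled.aestronglyMeasurable]
  refine ((integrable_gaussScaled (d := d) hσ).const_mul
    ((σ ^ d)⁻¹ * (2 * Real.pi) ^ (-(d : ℝ) / 2))).mono'
    (continuous_gaussScaled.pow 2).aestronglyMeasurable (Eventually.of_forall fun u => ?_)
  have h := gaussScaled_nonneg (d := d) hσ u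
  rw [Real.norm_of_nonneg (by positivity), sq]
  exact mul_le_mul_of_nonneg_right (mul_le_mul_of_nonneg_left (gauss_le _) (by positivity)) h

theorem gauss_le_of_norm_le {κ : ℝ} {a b : Dom d} (h : ‖a‖ ≤ 2 * ‖b‖ + κ) :
    gauss d b ≤ Real.exp (κ ^ 2 / 8) * gauss d ((4 : ℝ)⁻¹ • a) := by
  unfold gauss
  rw [mul_left_comm, ← Real.exp_add]
  gcongr
  rw [norm_smul, Real.norm_of_nonneg (by norm_num)]
  nlinarith [sq_nonneg (2 * ‖b‖ - κ), norm_nonneg a, sq_nonneg ‖a‖]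

/-- Perturbing the argument of the Gaussian and multiplying it by a factor close to `1` changes
it by at most a multiple of a wider Gaussian. -/
theorem exists_abs_gauss_sub_le (d : ℕ) (κ : ℝ) (hκ : 0 < κ) :
    ∃ C : ℝ, 0 ≤ C ∧ ∀ (ε : ℝ) (a b : Dom d) (D : ℝ), 0 ≤ ε → ε ≤ 1 / 2 →
      ‖b‖ ≤ ε * (‖a‖ + κ) → |D - 1| ≤ d * 2 ^ d * ε →
      |gauss d a - D * gauss d (a - b)| ≤ C * ε * gauss d ((4 : ℝ)⁻¹ • a) := by
  have hexp : ∀ s t m : ℝ, m ≤ s → m ≤ t →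
      |Real.exp (-s) - Real.exp (-t)| ≤ |s - t| * Real.exp (-m) := by
    have key : ∀ s t m : ℝ, m ≤ s → s ≤ t →
        |Real.exp (-s) - Real.exp (-t)| ≤ |s - t| * Real.exp (-m) := by
      intro s t m hm hst
      rw [abs_of_nonneg (sub_nonneg.2 (Real.exp_le_exp.2 (by linarith))),
        abs_of_nonpos (by linarith)]
      have h1 : Real.exp (-t) = Real.exp (-s) * Real.exp (s - t) := by
        rw [← Real.exp_add]; congr 1; ring
      have h2 := Real.add_one_le_exp (s - t)
      have h3 : Real.exp (-s) ≤ Real.exp (-m) := Real.exp_le_exp.2 (by linarith)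
      rw [h1]
      have h4 : Real.exp (-s) * (1 - Real.exp (s - t)) ≤ Real.exp (-s) * (t - s) :=
        mul_le_mul_of_nonneg_left (by linarith) (Real.exp_pos _).le
      have h5 : Real.exp (-s) * (t - s) ≤ Real.exp (-m) * (t - s) :=
        mul_le_mul_of_nonneg_right h3 (by linarith)
      linarith
    intro s t m hs ht
    rcases le_total s t with h | h
    · exact key s t m hs h
    · rw [abs_sub_comm, abs_sub_comm s t]
      exact key t s m ht h
  refine ⟨2 * (64 + 2 * κ ^ 2) * Real.exp (κ ^ 2 / 8) + d * 2 ^ d * Real.exp (κ ^ 2 / 8),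
    by positivity, fun ε a b D hε hε2 hb hD => ?_⟩
  set r := ‖a‖ with hr
  set y := ‖a - b‖ with hy
  have hr0 : 0 ≤ r := norm_nonneg _
  have hy0 : 0 ≤ y := norm_nonneg _
  have hry : |r - y| ≤ ε * (r + κ) := by
    refine (abs_norm_sub_norm_le a (a - b)).trans ?_
    rwa [sub_sub_cancel]
  -- With `ε ≤ 1/2` the perturbed radius satisfies `r ≤ 2y + κ`, so decay in `y` can be traded for
  -- slower decay in `r`.
  have hεr : ε * (r + κ) ≤ 1 / 2 * (r + κ) := by gcongr
  obtain ⟨hry1, hry2⟩ := abs_le.1 (hry.trans hεr)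
  have hg0 := gauss_nonneg ((4 : ℝ)⁻¹ • a)
  have h2 : |(1 - D) * gauss d (a - b)| ≤
      d * 2 ^ d * ε * (Real.exp (κ ^ 2 / 8) * gauss d ((4 : ℝ)⁻¹ • a)) := by
    rw [abs_mul, abs_sub_comm, abs_of_nonneg (gauss_nonneg _)]
    have h3 : gauss d (a - b) ≤ Real.exp (κ ^ 2 / 8) * gauss d ((4 : ℝ)⁻¹ • a) :=
      gauss_le_of_norm_le (by linarith)
    exact mul_le_mul hD h3 (gauss_nonneg _) (by positivity)
  have h1 : |gauss d a - gauss d (a - b)| ≤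
      2 * (64 + 2 * κ ^ 2) * Real.exp (κ ^ 2 / 8) * ε * gauss d ((4 : ℝ)⁻¹ • a) := by
    unfold gauss
    rw [← mul_sub, abs_mul, abs_of_nonneg (by positivity), ← hr, ← hy, neg_div 2 (r ^ 2), neg_div 2 (y ^ 2),
      norm_smul, Real.norm_of_nonneg (by norm_num), ← hr]
    have hm1 : r ^ 2 / 16 - κ ^ 2 / 8 ≤ y ^ 2 / 2 := by
      nlinarith [sq_nonneg (2 * y - κ)]
    have hm2 : r ^ 2 / 16 - κ ^ 2 / 8 ≤ r ^ 2 / 2 := by nlinarith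
    have h4 := hexp (r ^ 2 / 2) (y ^ 2 / 2) _ hm2 hm1
    have h5 : |r ^ 2 / 2 - y ^ 2 / 2| ≤ 2 * ε * (r + κ) ^ 2 := by
      rw [show r ^ 2 / 2 - y ^ 2 / 2 = (r - y) * ((r + y) / 2) by ring, abs_mul,
        abs_of_nonneg (by positivity : 0 ≤ (r + y) / 2)]
      calc |r - y| * ((r + y) / 2) ≤ ε * (r + κ) * (2 * (r + κ)) := by
            gcongr; linarith
        _ = _ := by ring
    -- Half of the exponent `r²/16` absorbs the polynomial; the other half, `r²/32`, is the exponent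
    -- of the Gaussian at `a/4`. This fixes the widening factor `4`.
    have h6 : (r + κ) ^ 2 * Real.exp (-(r ^ 2 / 16 - κ ^ 2 / 8)) ≤
        (64 + 2 * κ ^ 2) * Real.exp (κ ^ 2 / 8) * Real.exp (-(4⁻¹ * r) ^ 2 / 2) := by
      have e1 : Real.exp (-(r ^ 2 / 16 - κ ^ 2 / 8)) =
          Real.exp (-(r ^ 2 / 32)) * (Real.exp (κ ^ 2 / 8) * Real.exp (-(4⁻¹ * r) ^ 2 / 2)) := by
        rw [← Real.exp_add, ← Real.exp_add]; congr 1; ring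
      rw [e1, ← mul_assoc, mul_assoc (64 + 2 * κ ^ 2)]
      gcongr
      have h7 := Real.add_one_le_exp (r ^ 2 / 32)
      have h8 : Real.exp (-(r ^ 2 / 32)) * Real.exp (r ^ 2 / 32) = 1 := by
        rw [← Real.exp_add]; simp
      have h9 : (r + κ) ^ 2 ≤ (64 + 2 * κ ^ 2) * Real.exp (r ^ 2 / 32) := by
        have h10 : (64 + 2 * κ ^ 2) * (r ^ 2 / 32 + 1) ≤ (64 + 2 * κ ^ 2) * Real.exp (r ^ 2 / 32) := by
          gcongr
        nlinarith [sq_nonneg (r - κ), sq_nonneg (κ * r)]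
      calc (r + κ) ^ 2 * Real.exp (-(r ^ 2 / 32))
          ≤ (64 + 2 * κ ^ 2) * Real.exp (r ^ 2 / 32) * Real.exp (-(r ^ 2 / 32)) := by gcongr
        _ = 64 + 2 * κ ^ 2 := by rw [mul_assoc, mul_comm (Real.exp (r ^ 2 / 32)), h8, mul_one]
    set c := (2 * Real.pi) ^ (-(d : ℝ) / 2)
    calc c * |Real.exp (-(r ^ 2 / 2)) - Real.exp (-(y ^ 2 / 2))|
        ≤ c * (2 * ε * (r + κ) ^ 2 * Real.exp (-(r ^ 2 / 16 - κ ^ 2 / 8))) := by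
          gcongr
          exact h4.trans (by gcongr)
      _ = c * 2 * ε * ((r + κ) ^ 2 * Real.exp (-(r ^ 2 / 16 - κ ^ 2 / 8))) := by ring
      _ ≤ c * 2 * ε * ((64 + 2 * κ ^ 2) * Real.exp (κ ^ 2 / 8) *
            Real.exp (-(4⁻¹ * r) ^ 2 / 2)) := by gcongr
      _ = _ := by ring
  have e : gauss d a - D * gauss d (a - b) =
      (gauss d a - gauss d (a - b)) + (1 - D) * gauss d (a - b) := by ring
  rw [e]
  refine (abs_add_le _ _).trans ((add_le_add h1 h2).trans_eq ?_)
  ring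

theorem gauss_inv_smul_smul (hσ : 0 < σ) (u : Dom d) :
    (σ ^ d)⁻¹ * gauss d ((4 : ℝ)⁻¹ • σ⁻¹ • u) = 4 ^ d * gaussScaled d (4 * σ) u := by
  unfold gaussScaled
  rw [smul_smul, ← mul_inv, mul_pow]
  field_simp

theorem exists_abs_gaussScaled_sub_le (d : ℕ) (κ : ℝ) (hκ : 0 < κ) :
    ∃ C : ℝ, 0 ≤ C ∧ ∀ (σ ε : ℝ) (a b : Dom d) (D : ℝ), 0 < σ → 0 ≤ ε → ε ≤ 1 / 2 →
      ‖b‖ ≤ ε * (‖a‖ + κ * σ) → |D - 1| ≤ d * 2 ^ d * ε →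
      |gaussScaled d σ a - D * gaussScaled d σ (a - b)| ≤ C * ε * gaussScaled d (4 * σ) a := by
  obtain ⟨C, hC, h⟩ := exists_abs_gauss_sub_le d κ hκ
  refine ⟨C * 4 ^ d, by positivity, fun σ ε a b D hσ hε hε2 hb hD => ?_⟩
  have hb' : ‖σ⁻¹ • b‖ ≤ ε * (‖σ⁻¹ • a‖ + κ) := by
    rw [norm_smul, norm_smul, Real.norm_of_nonneg (by positivity)]
    calc σ⁻¹ * ‖b‖ ≤ σ⁻¹ * (ε * (‖a‖ + κ * σ)) := by gcongr
      _ = _ := by field_simp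
  have h1 := h ε (σ⁻¹ • a) (σ⁻¹ • b) D hε hε2 hb' hD
  rw [← smul_sub] at h1
  have e : gaussScaled d σ a - D * gaussScaled d σ (a - b) =
      (σ ^ d)⁻¹ * (gauss d (σ⁻¹ • a) - D * gauss d (σ⁻¹ • (a - b))) := by
    unfold gaussScaled; ring
  rw [e, abs_mul, abs_of_nonneg (by positivity)]
  calc _ ≤ (σ ^ d)⁻¹ * (C * ε * gauss d ((4 : ℝ)⁻¹ • σ⁻¹ • a)) := by gcongr
    _ = C * ε * ((σ ^ d)⁻¹ * gauss d ((4 : ℝ)⁻¹ • σ⁻¹ • a)) := by ring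
    _ = _ := by rw [gauss_inv_smul_smul hσ]; ring

/-- A domination that is uniform over a ball of centres, used for dominated convergence in
`continuous_pooling`. -/
theorem gaussScaled_le_of_norm_sub_le (hσ : 0 < σ) {a b : Dom d} (h : ‖a - b‖ ≤ σ) :
    gaussScaled d σ b ≤ Real.exp (1 / 8) * 4 ^ d * gaussScaled d (4 * σ) a := by
  have h1 : ‖σ⁻¹ • a‖ ≤ 2 * ‖σ⁻¹ • b‖ + 1 := by
    have h2 : ‖σ⁻¹ • a‖ ≤ ‖σ⁻¹ • b‖ + 1 := by
      calc ‖σ⁻¹ • a‖ = ‖σ⁻¹ • b + σ⁻¹ • (a - b)‖ := by rw [← smul_add, add_sub_cancel]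
        _ ≤ ‖σ⁻¹ • b‖ + ‖σ⁻¹ • (a - b)‖ := norm_add_le _ _
        _ ≤ _ := by
          gcongr
          rw [norm_smul, Real.norm_of_nonneg (by positivity)]
          exact (inv_mul_le_one₀ hσ).2 h
    linarith [norm_nonneg (σ⁻¹ • b)]
  have h2 := gauss_le_of_norm_le h1
  rw [one_pow] at h2
  rw [mul_assoc, ← gauss_inv_smul_smul hσ, mul_left_comm]
  exact mul_le_mul_of_nonneg_left h2 (by positivity)

end Gaussian

/-! ### Pooling on `L²` and its commutator with deformations. -/

section Pooling

variable {d : ℕ} {σ : ℝ} {H : HilbertSp.{u}} {y z : Dom d → H}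

theorem integrable_gaussScaled_sub_smul (hσ : 0 < σ) (hy : MemLp y 2 volume) (u : Dom d) :
    Integrable fun v => gaussScaled d σ (u - v) • y v := by
  have h : MemLp (fun v => gaussScaled d σ (u - v)) 2 volume :=
    (memLp_gaussScaled hσ).comp_measurePreserving (Measure.measurePreserving_sub_left volume u)
  exact memLp_one_iff_integrable.1 (hy.smul h)

/-- Continuity makes pointwise patches of a pooled signal meaningful and supplies the joint
measurability needed for Tonelli. -/
theorem continuous_pooling (hσ : 0 < σ) (hy : MemLp y 2 volume) : Continuous (pooling σ y) := by
  refine continuous_iff_continuousAt.2 fun u₀ => ?_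
  refine continuousAt_of_dominated (bound := fun v => Real.exp (1 / 8) * 4 ^ d *
    ‖gaussScaled d (4 * σ) (u₀ - v) • y v‖) ?_ ?_ ?_ ?_
  · exact Eventually.of_forall fun u => (integrable_gaussScaled_sub_smul hσ hy u).1
  · filter_upwards [Metric.closedBall_mem_nhds u₀ hσ] with u hu
    refine Eventually.of_forall fun v => ?_
    rw [norm_smul, norm_smul, Real.norm_of_nonneg (gaussScaled_nonneg hσ _),
      Real.norm_of_nonneg (gaussScaled_nonneg (by positivity) _), ← mul_assoc]
    refine mul_le_mul_of_nonneg_right (gaussScaled_le_of_norm_sub_le hσ ?_) (norm_nonneg _)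
    rwa [sub_sub_sub_cancel_right, ← dist_eq_norm, dist_comm]
  · exact (integrable_gaussScaled_sub_smul (by positivity) hy u₀).norm.const_mul _
  · refine Eventually.of_forall fun v => Continuous.continuousAt ?_
    exact (continuous_gaussScaled.comp (continuous_id.sub continuous_const)).smul continuous_const

theorem pooling_sub (hσ : 0 < σ) (hy : MemLp y 2 volume) (hz : MemLp z 2 volume) (u : Dom d) :
    pooling σ (y - z) u = pooling σ y u - pooling σ z u := by
  unfold pooling
  rw [← integral_sub (integrable_gaussScaled_sub_smul hσ hy u)
    (integrable_gaussScaled_sub_smul hσ hz u)]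
  simp only [Pi.sub_apply, smul_sub]

/-- A function dominated by a Gaussian average of `f` is bounded in `L²` by `f`. -/
theorem lintegral_sq_le_of_le_lintegral_gaussScaled (hσ : 0 < σ) {f g : Dom d → ℝ≥0∞}
    (hf : AEMeasurable f volume) (c : Dom d) (M : ℝ≥0∞)
    (h : ∀ u, g u ≤ ∫⁻ v, M * ENNReal.ofReal (gaussScaled d σ (u + c - v)) * f v) :
    ∫⁻ u, g u ^ 2 ≤ M ^ 2 * ∫⁻ v, f v ^ 2 := by
  have hm : Measurable fun u => ENNReal.ofReal (gaussScaled d σ u) :=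
    continuous_gaussScaled.measurable.ennreal_ofReal
  refine (lintegral_mono fun u => ENNReal.pow_le_pow_left (h u)).trans ?_
  refine lintegral_sq_lintegral_mul_le (K := fun u v =>
    M * ENNReal.ofReal (gaussScaled d σ (u + c - v))) ?_ hf (fun u => ?_) (fun v => ?_)
  · exact (hm.comp ((measurable_fst.add_const c).sub measurable_snd)).const_mul M
  · refine (lintegral_const_mul M (hm.comp (measurable_const.sub measurable_id))).trans_le ?_
    simp only [Function.comp_def, Pi.sub_apply, id_eq]
    rw [lintegral_sub_left_eq_self (fun v => ENNReal.ofReal (gaussScaled d σ v)),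
      lintegral_gaussScaled hσ, mul_one]
  · simp only [add_sub_assoc]
    refine (lintegral_const_mul M (hm.comp (measurable_id.add_const (c - v)))).trans_le ?_
    simp only [Function.comp_def, id_eq]
    rw [lintegral_add_right_eq_self (fun v => ENNReal.ofReal (gaussScaled d σ v)),
      lintegral_gaussScaled hσ, mul_one]

theorem enorm_pooling_le (hσ : 0 < σ) (u : Dom d) :
    ‖pooling σ y u‖ₑ ≤ ∫⁻ v, ENNReal.ofReal (gaussScaled d σ (u - v)) * ‖y v‖ₑ := by
  refine (enorm_integral_le_lintegral_enorm _).trans_eq (lintegral_congr fun v => ?_)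
  rw [enorm_smul, Real.enorm_of_nonneg (gaussScaled_nonneg hσ _)]

theorem eLpNorm_pooling_le (hσ : 0 < σ) (hy : AEStronglyMeasurable y volume) :
    eLpNorm (pooling σ y) 2 volume ≤ eLpNorm y 2 volume := by
  rw [eLpNorm_two_le_iff, eLpNorm_two_sq]
  have h := lintegral_sq_le_of_le_lintegral_gaussScaled hσ hy.enorm 0 1
    (g := fun u => ‖pooling σ y u‖ₑ) (fun u => by simpa using enorm_pooling_le hσ u)
  simpa using h

theorem memLp_pooling (hσ : 0 < σ) (hy : MemLp y 2 volume) : MemLp (pooling σ y) 2 volume :=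
  ⟨(continuous_pooling hσ hy).aestronglyMeasurable, (eLpNorm_pooling_le hσ hy.1).trans_lt hy.2⟩

/-- The commutator of a deformation with a translated Gaussian average, as an operator on `L²`,
is bounded by the size of the Jacobian of the deformation. -/
theorem exists_eLpNorm_pooling_deform_sub_le (d : ℕ) (κ : ℝ) (hκ : 0 < κ) :
    ∃ C : ℝ, 0 ≤ C ∧ ∀ (H : HilbertSp.{u}) (σ ε : ℝ) (c : Dom d) (τ : Dom d → Dom d)
      (y : Dom d → H), 0 < σ → ‖c‖ ≤ κ * σ → ContDiff ℝ 1 τ → (∀ u, ‖fderiv ℝ τ u‖ ≤ ε) →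
      ε ≤ 1 / 2 → MemLp y 2 volume →
      eLpNorm (fun u => pooling σ (deform τ y) (u + c) - pooling σ y (u - τ u + c)) 2 volume ≤
        ENNReal.ofReal (C * ε) * eLpNorm y 2 volume := by
  obtain ⟨C, hC, hker⟩ := exists_abs_gaussScaled_sub_le d κ hκ
  refine ⟨C * 2 ^ d, by positivity, fun H σ ε c τ y hσ hc hτ hε hε2 hy => ?_⟩
  have hε0 : 0 ≤ ε := (norm_nonneg _).trans (hε 0)
  have hε1 : ε < 1 := by linarith
  have hyτ := memLp_deform hτ hε hε2 hy
  have hkey : ∀ u, ‖pooling σ (deform τ y) (u + c) - pooling σ y (u - τ u + c)‖ₑ ≤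
      ∫⁻ v, ENNReal.ofReal (C * ε) * ENNReal.ofReal (gaussScaled d (4 * σ) (u + c - v)) *
        ‖deform τ y v‖ₑ := by
    intro u
    have hi := integrable_gaussScaled_sub_smul hσ hy (u - τ u + c)
    rw [integrable_comp_id_sub_iff hτ hε hε1] at hi
    -- After this substitution both terms integrate the same function `deform τ y`, so their
    -- difference has a single kernel.
    have e : pooling σ y (u - τ u + c) = ∫ v, |(1 - fderiv ℝ τ v).det| •
        gaussScaled d σ (u - τ u + c - (v - τ v)) • y (v - τ v) :=
      integral_comp_id_sub hτ hε hε1 _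
    rw [e, pooling, ← integral_sub (integrable_gaussScaled_sub_smul hσ hyτ (u + c)) hi]
    refine (enorm_integral_le_lintegral_enorm _).trans (lintegral_mono fun v => ?_)
    rw [smul_smul, deform, ← sub_smul, enorm_smul, ← ENNReal.ofReal_mul (by positivity)]
    gcongr
    rw [Real.enorm_eq_ofReal_abs]
    refine ENNReal.ofReal_le_ofReal ?_
    rw [show u - τ u + c - (v - τ v) = (u + c - v) - (τ u - τ v) by abel]
    refine hker σ ε _ _ _ hσ hε0 hε2 ?_ ?_
    -- The shift costs only `|u - v| ≤ |u + c - v| + κσ`; here the patch size enters.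
    · refine (norm_sub_le_of_fderiv_le hτ hε u v).trans ?_
      gcongr
      calc ‖u - v‖ = ‖(u + c - v) - c‖ := by congr 1; abel
        _ ≤ _ := (norm_sub_le _ _).trans (by gcongr)
    · simpa using abs_abs_det_one_sub_sub_one_le (hε v) hε1
  have h := lintegral_sq_le_of_le_lintegral_gaussScaled (by positivity : 0 < 4 * σ)
    hyτ.1.enorm c _ hkey
  rw [← eLpNorm_two_sq (deform τ y), ← mul_pow, ← eLpNorm_two_le_iff] at h
  refine h.trans ((mul_le_mul_right (eLpNorm_deform_le hτ hε hε2) _).trans_eq ?_)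
  rw [← mul_assoc, mul_right_comm C, ENNReal.ofReal_mul (p := C * ε) (by positivity),
    ENNReal.ofReal_pow (by norm_num), ENNReal.ofReal_ofNat]

end Pooling

/-! ### Displacement of a pooled signal by `τ`. -/

section Translation

variable {d : ℕ} {σ : ℝ}

theorem norm_fderiv_gauss_le (u : Dom d) : ‖fderiv ℝ (gauss d) u‖ ≤ gauss d ((4 : ℝ)⁻¹ • u) := by
  have h1 : HasFDerivAt (fun u : Dom d => -‖u‖ ^ 2 / 2) (-innerSL ℝ u) u := by
    have h := ((hasStrictFDerivAt_norm_sq u).hasFDerivAt.neg).mul_const (2⁻¹ : ℝ)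
    refine h.congr_fderiv ?_
    ext v
    simp
  have h2 : HasFDerivAt (gauss d) _ u := h1.exp.const_mul ((2 * Real.pi) ^ (-(d : ℝ) / 2))
  rw [h2.fderiv, norm_smul, norm_smul, norm_neg, innerSL_apply_norm,
    Real.norm_of_nonneg (by positivity), Real.norm_of_nonneg (by positivity)]
  unfold gauss
  gcongr
  rw [norm_smul, Real.norm_of_nonneg (by norm_num)]
  have h3 : ‖u‖ ≤ Real.exp (‖u‖ ^ 2 / 4) := by
    nlinarith [Real.add_one_le_exp (‖u‖ ^ 2 / 4), sq_nonneg (‖u‖ - 2)]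
  calc Real.exp (-‖u‖ ^ 2 / 2) * ‖u‖
      ≤ Real.exp (-‖u‖ ^ 2 / 2) * Real.exp (‖u‖ ^ 2 / 4) := by gcongr
    _ = Real.exp (-‖u‖ ^ 2 / 4) := by rw [← Real.exp_add]; congr 1; ring
    _ ≤ _ := Real.exp_le_exp.2 (by nlinarith [sq_nonneg ‖u‖])

theorem integrable_fderiv_gauss : Integrable (fderiv ℝ (gauss d)) := by
  refine (integrable_gauss.comp_smul (R := (4 : ℝ)⁻¹) (by norm_num)).mono'
    (contDiff_gauss.continuous_fderiv one_ne_zero).aestronglyMeasurable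
    (Eventually.of_forall norm_fderiv_gauss_le)

theorem contDiff_gaussScaled : ContDiff ℝ 1 (gaussScaled d σ) :=
  contDiff_const.mul (contDiff_gauss.comp (contDiff_const_smul _))

theorem fderiv_gaussScaled (u : Dom d) :
    fderiv ℝ (gaussScaled d σ) u = ((σ ^ d)⁻¹ * σ⁻¹) • fderiv ℝ (gauss d) (σ⁻¹ • u) := by
  have h := ((contDiff_gauss.differentiable one_ne_zero) (σ⁻¹ • u)).hasFDerivAt.comp u
    ((hasFDerivAt_id u).const_smul σ⁻¹)
  have h' : HasFDerivAt (gaussScaled d σ) _ u := h.const_mul ((σ ^ d)⁻¹)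
  rw [h'.fderiv]
  ext v
  simp [mul_assoc]

/-- By scaling, `‖∇h_σ‖₁ = ‖∇h‖₁ / σ`. -/
theorem two_pow_mul_lintegral_enorm_fderiv_gaussScaled (hσ : 0 < σ) :
    2 ^ d * ∫⁻ u : Dom d, ‖fderiv ℝ (gaussScaled d σ) u‖ₑ =
      ENNReal.ofReal (transConst d / σ) := by
  have hint : Integrable fun u : Dom d => fderiv ℝ (gaussScaled d σ) u := by
    simp only [fderiv_gaussScaled]
    exact (integrable_fderiv_gauss.comp_smul (inv_ne_zero hσ.ne')).smul ((σ ^ d)⁻¹ * σ⁻¹)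
  have hgrad : ∀ u : Dom d, ‖gradient (gauss d) u‖ = ‖fderiv ℝ (gauss d) u‖ := fun u =>
    LinearIsometryEquiv.norm_map _ _
  rw [← ofReal_integral_norm_eq_lintegral_enorm hint, transConst, mul_div_assoc,
    ENNReal.ofReal_mul (by positivity), ENNReal.ofReal_pow (by norm_num), ENNReal.ofReal_ofNat]
  congr 2
  simp only [fderiv_gaussScaled, hgrad, norm_smul]
  rw [integral_const_mul, Measure.integral_comp_smul volume fun u => ‖fderiv ℝ (gauss d) u‖,
    finrank_euclideanSpace_fin, Real.norm_of_nonneg (by positivity), abs_of_pos (by positivity)]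
  simp only [inv_pow, inv_inv, smul_eq_mul]
  field_simp

/-- The average over the segment is kept instead of a supremum, so that Tonelli later recovers the
exact `L¹` norm of the gradient. -/
theorem enorm_sub_le_lintegral_enorm_fderiv {E : Type*} [NormedAddCommGroup E] [NormedSpace ℝ E]
    {f : E → ℝ} (hf : ContDiff ℝ 1 f) (a b : E) :
    ‖f (a - b) - f a‖ₑ ≤ ‖b‖ₑ * ∫⁻ t in Set.Ioc (0 : ℝ) 1, ‖fderiv ℝ f (a - t • b)‖ₑ := by
  have hd : ∀ t : ℝ, HasDerivAt (fun t : ℝ => f (a - t • b)) (fderiv ℝ f (a - t • b) (-b)) t := by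
    intro t
    have h1 : HasDerivAt (fun t : ℝ => a - t • b) (-b) t := by
      simpa using ((hasDerivAt_id t).smul_const b).const_sub a
    exact ((hf.differentiable one_ne_zero) (a - t • b)).hasFDerivAt.comp_hasDerivAt t h1
  have hc : Continuous fun t : ℝ => fderiv ℝ f (a - t • b) :=
    (hf.continuous_fderiv one_ne_zero).comp (by fun_prop)
  have h := intervalIntegral.integral_eq_sub_of_hasDerivAt (fun t _ => hd t)
    ((hc.clm_apply continuous_const).intervalIntegrable 0 1)
  rw [one_smul, zero_smul, sub_zero, intervalIntegral.integral_of_le zero_le_one] at h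
  rw [← h, ← lintegral_const_mul' _ _ enorm_ne_top]
  refine (enorm_integral_le_lintegral_enorm _).trans (lintegral_mono fun t => ?_)
  refine (ContinuousLinearMap.le_opENorm _ _).trans_eq ?_
  rw [enorm_neg, mul_comm]

/-- Schur's test for the kernel `‖τ‖_∞ ∫₀¹ |∇h_σ(u - v - tτ(u))| dt`. In `v` it integrates by
translation invariance; in `u` the change of variables `u ↦ u - tτ(u)` costs `2^d`, uniformly in
`t`, since `tτ` satisfies the same gradient bound. -/
theorem eLpNorm_pooling_comp_id_sub_sub_le {H : HilbertSp.{u}} {y : Dom d → H}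
    {τ : Dom d → Dom d} {ε : ℝ} (hσ : 0 < σ) (hτ : ContDiff ℝ 1 τ)
    (hε : ∀ u, ‖fderiv ℝ τ u‖ ≤ ε) (hε2 : ε ≤ 1 / 2) (hy : MemLp y 2 volume) :
    eLpNorm (fun u => pooling σ y (u - τ u) - pooling σ y u) 2 volume ≤
      ENNReal.ofReal (transConst d / σ) * supNorm τ * eLpNorm y 2 volume := by
  set W : Dom d → ℝ≥0∞ := fun x => ‖fderiv ℝ (gaussScaled d σ) x‖ₑ with hW
  have hWc : Continuous W := (contDiff_gaussScaled.continuous_fderiv one_ne_zero).enorm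
  have hτc := hτ.continuous
  let K : Dom d → Dom d → ℝ≥0∞ := fun u v =>
    supNorm τ * ∫⁻ t in Set.Ioc (0 : ℝ) 1, W (u - v - t • τ u)
  have hK : Measurable (Function.uncurry K) := by
    refine Measurable.const_mul (Measurable.lintegral_prod_right'
      (f := fun p : (Dom d × Dom d) × ℝ => W (p.1.1 - p.1.2 - p.2 • τ p.1.1)) ?_) _
    exact (hWc.comp (by fun_prop)).measurable
  have hpt : ∀ u, ‖pooling σ y (u - τ u) - pooling σ y u‖ₑ ≤ ∫⁻ v, K u v * ‖y v‖ₑ := by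
    intro u
    unfold pooling
    rw [← integral_sub (integrable_gaussScaled_sub_smul hσ hy _)
      (integrable_gaussScaled_sub_smul hσ hy u)]
    refine (enorm_integral_le_lintegral_enorm _).trans (lintegral_mono fun v => ?_)
    rw [← sub_smul, enorm_smul, sub_right_comm]
    gcongr
    refine (enorm_sub_le_lintegral_enorm_fderiv contDiff_gaussScaled _ _).trans ?_
    exact mul_le_mul_left (le_iSup (fun u => ‖τ u‖ₑ) u) _
  have h1 : ∀ u, ∫⁻ v, K u v ≤ ENNReal.ofReal (transConst d / σ) * supNorm τ := by
    intro u
    have hm : Measurable fun v => ∫⁻ t in Set.Ioc (0 : ℝ) 1, W (u - v - t • τ u) :=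
      Measurable.lintegral_prod_right' (f := fun p : Dom d × ℝ => W (u - p.1 - p.2 • τ u))
        (hWc.comp (by fun_prop)).measurable
    rw [lintegral_const_mul _ hm, mul_comm]
    refine mul_le_mul_left ?_ _
    rw [lintegral_lintegral_swap
      (f := fun (v : Dom d) (t : ℝ) => W (u - v - t • τ u))
      (hWc.comp (by fun_prop)).measurable.aemeasurable]
    have h2 : ∀ t : ℝ, ∫⁻ v, W (u - v - t • τ u) = ∫⁻ v, W v := fun t => by
      simp only [sub_right_comm u _ (t • τ u)]
      exact lintegral_sub_left_eq_self W _
    simp only [h2, lintegral_const, Measure.restrict_apply_univ, Real.volume_Ioc, sub_zero,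
      ENNReal.ofReal_one, mul_one]
    rw [← two_pow_mul_lintegral_enorm_fderiv_gaussScaled hσ]
    exact le_mul_of_one_le_left' (one_le_pow₀ one_le_two)
  have h2 : ∀ v, ∫⁻ u, K u v ≤ ENNReal.ofReal (transConst d / σ) * supNorm τ := by
    intro v
    have hm : Measurable fun u => ∫⁻ t in Set.Ioc (0 : ℝ) 1, W (u - v - t • τ u) :=
      Measurable.lintegral_prod_right' (f := fun p : Dom d × ℝ => W (p.1 - v - p.2 • τ p.1))
        (hWc.comp (by fun_prop)).measurable
    rw [lintegral_const_mul _ hm, mul_comm]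
    refine mul_le_mul_left ?_ _
    rw [lintegral_lintegral_swap
      (f := fun (u : Dom d) (t : ℝ) => W (u - v - t • τ u))
      (hWc.comp (by fun_prop)).measurable.aemeasurable,
      ← two_pow_mul_lintegral_enorm_fderiv_gaussScaled hσ]
    have h3 : ∀ t ∈ Set.Ioc (0 : ℝ) 1, ∫⁻ u, W (u - v - t • τ u) ≤ 2 ^ d * ∫⁻ u, W u := by
      intro t ht
      have hε' : ∀ u, ‖fderiv ℝ (fun u => t • τ u) u‖ ≤ ε := fun u => by
        rw [fderiv_fun_const_smul ((hτ.differentiable one_ne_zero) u), norm_smul,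
          Real.norm_of_nonneg ht.1.le]
        exact (mul_le_of_le_one_left (norm_nonneg _) ht.2).trans (hε u)
      have h := lintegral_comp_id_sub_le (hτ.const_smul t) hε' hε2 fun u => W (u - v)
      simp only [sub_right_comm _ v]
      refine h.trans_eq ?_
      rw [lintegral_sub_right_eq_self W v]
    refine (setLIntegral_mono' measurableSet_Ioc h3).trans_eq ?_
    simp [hW]
  have h := lintegral_sq_lintegral_mul_le hK hy.1.enorm h1 h2
  rw [← eLpNorm_two_sq y, ← mul_pow] at h
  rw [eLpNorm_two_le_iff]
  exact (lintegral_mono fun u => ENNReal.pow_le_pow_left (hpt u)).trans h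

end Translation

/-! ### Patch extraction on continuous signals. -/

section Patch

variable {d : ℕ} {S : Set (Dom d)} {H : HilbertSp.{u}} {x y : Dom d → H}

theorem isProbabilityMeasure_cond (hS : IsCompact S) (hS0 : 0 < volume S) :
    IsProbabilityMeasure (ProbabilityTheory.cond (volume : Measure (Dom d)) S) :=
  ProbabilityTheory.cond_isProbabilityMeasure_of_finite hS0.ne' hS.measure_lt_top.ne

theorem memLp_patch (hS : IsCompact S) (hS0 : 0 < volume S) (hx : Continuous x) (u : Dom d) :
    MemLp (fun v => x (u + v)) 2 (ProbabilityTheory.cond (volume : Measure (Dom d)) S) := by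
  have := isProbabilityMeasure_cond hS hS0
  have hc : Continuous fun v => x (u + v) := hx.comp (continuous_const_add u)
  obtain ⟨C, hC⟩ := hS.exists_bound_of_continuousOn hc.continuousOn
  refine MemLp.of_bound hc.aestronglyMeasurable C ?_
  filter_upwards [ProbabilityTheory.ae_cond_mem hS.measurableSet] with v hv using hC v hv

theorem patchExtraction_of_memLp {u : Dom d}
    (h : MemLp (fun v => x (u + v)) 2 (ProbabilityTheory.cond (volume : Measure (Dom d)) S)) :
    patchExtraction S x u = h.toLp (fun v => x (u + v)) :=
  dif_pos h

theorem enorm_patchExtraction_sub_sq (hS : IsCompact S) (hS0 : 0 < volume S) (hx : Continuous x)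
    (hy : Continuous y) (u w : Dom d) :
    ‖patchExtraction S x u - patchExtraction S y w‖ₑ ^ 2 =
      ∫⁻ v, ‖x (u + v) - y (w + v)‖ₑ ^ 2 ∂ProbabilityTheory.cond (volume : Measure (Dom d)) S := by
  have h1 := memLp_patch hS hS0 hx u
  have h2 := memLp_patch hS hS0 hy w
  rw [patchExtraction_of_memLp h1, patchExtraction_of_memLp h2]
  change ‖h1.toLp _ - h2.toLp _‖ₑ ^ 2 = _
  rw [← MemLp.toLp_sub, Lp.enorm_toLp, eLpNorm_two_sq]
  rfl

theorem patchExtraction_zero (u : Dom d) : patchExtraction S (0 : Dom d → H) u = 0 :=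
  (patchExtraction_of_memLp MemLp.zero').trans (MemLp.toLp_zero MemLp.zero')

theorem continuous_patchExtraction (hS : IsCompact S) (hS0 : 0 < volume S) (hx : Continuous x) :
    Continuous (patchExtraction S x) := by
  have := isProbabilityMeasure_cond hS hS0
  refine continuous_iff_continuousAt.2 fun u₀ => ?_
  rw [ContinuousAt, tendsto_iff_edist_tendsto_0, ENNReal.tendsto_nhds_zero]
  intro δ hδ
  -- Compactness of the patch makes the closeness uniform over it.
  have hev : ∀ᶠ u in 𝓝 u₀, ∀ v ∈ S, ‖x (u + v) - x (u₀ + v)‖ₑ < δ := by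
    refine hS.eventually_forall_of_forall_eventually fun v _ => ?_
    have hc : Continuous fun p : Dom d × Dom d => ‖x (p.1 + p.2) - x (u₀ + p.2)‖ₑ :=
      ((hx.comp (by fun_prop)).sub (hx.comp (by fun_prop))).enorm
    exact hc.continuousAt.eventually_lt continuousAt_const (by simpa using hδ)
  filter_upwards [hev] with u hu
  rw [edist_eq_enorm_sub, ← ENNReal.pow_le_pow_left_iff two_ne_zero,
    enorm_patchExtraction_sub_sq hS hS0 hx hx]
  refine (lintegral_mono_ae (g := fun _ => δ ^ 2) ?_).trans_eq (by simp)
  filter_upwards [ProbabilityTheory.ae_cond_mem hS.measurableSet] with v hv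
  exact ENNReal.pow_le_pow_left (hu v hv).le

/-- The `L²` distance of patch extractions is controlled uniformly over the shifts in the patch. -/
theorem eLpNorm_patchExtraction_sub_le (hS : IsCompact S) (hS0 : 0 < volume S) (hx : Continuous x)
    (hy : Continuous y) {w : Dom d → Dom d} (hw : Continuous w) {M : ℝ≥0∞}
    (h : ∀ v ∈ S, eLpNorm (fun u => x (u + v) - y (w u + v)) 2 volume ≤ M) :
    eLpNorm (fun u => patchExtraction S x u - patchExtraction S y (w u)) 2 volume ≤ M := by
  have := isProbabilityMeasure_cond hS hS0
  rw [eLpNorm_two_le_iff]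
  simp only [enorm_patchExtraction_sub_sq hS hS0 hx hy]
  have hc : Continuous fun p : Dom d × Dom d => ‖x (p.1 + p.2) - y (w p.1 + p.2)‖ₑ :=
    ((hx.comp (by fun_prop)).sub (hy.comp (by fun_prop))).enorm
  rw [lintegral_lintegral_swap (hc.measurable.pow_const 2).aemeasurable]
  refine (lintegral_mono_ae (g := fun _ => M ^ 2) ?_).trans_eq (by simp)
  filter_upwards [ProbabilityTheory.ae_cond_mem hS.measurableSet] with v hv
  exact eLpNorm_two_le_iff.1 (h v hv)

theorem eLpNorm_comp_add_right {E : Type*} [NormedAddCommGroup E] {f : Dom d → E}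
    (hf : Continuous f) (v : Dom d) :
    eLpNorm (fun u => f (u + v)) 2 volume = eLpNorm f 2 volume :=
  eLpNorm_comp_measurePreserving
    hf.aestronglyMeasurable (measurePreserving_add_right volume v)

theorem eLpNorm_patchExtraction_le (hS : IsCompact S) (hS0 : 0 < volume S) (hx : Continuous x) :
    eLpNorm (patchExtraction S x) 2 volume ≤ eLpNorm x 2 volume := by
  -- Compare with the zero signal; every shift of `x` has the same `L²` norm.
  have h := eLpNorm_patchExtraction_sub_le hS hS0 hx (continuous_const (y := (0 : H)))
    (w := id) continuous_id (M := eLpNorm x 2 volume)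
    (fun v _ => by simpa using (eLpNorm_comp_add_right hx v).le)
  have h0 : ∀ u, patchExtraction S (fun _ => (0 : H)) u = 0 := patchExtraction_zero
  simpa only [h0, sub_zero] using h

end Patch

/-! ### Integrability and continuity through the layers. -/

namespace Architecture

variable {d : ℕ} (N : Architecture d) (H₀ : HilbertSp.{u})

/-- The signal at layer `n` before pooling. -/
def unpooled : (n : ℕ) → (Dom d → H₀) → Dom d → N.featureSpace H₀ n
  | 0, x => x
  | k + 1, x => kernelMapping (N.dotFun k) (patchExtraction (N.patch k) (N.repr H₀ k x))

theorem repr_eq_pooling (n : ℕ) (x : Dom d → H₀) :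
    N.repr H₀ n x = pooling (N.scale n) (N.unpooled H₀ n x) := by
  cases n <;> rfl

variable {H₀} {x : Dom d → H₀}

theorem memLp_unpooled (hx : MemLp x 2 volume) (n : ℕ) :
    MemLp (N.unpooled H₀ n x) 2 volume ∧
      eLpNorm (N.unpooled H₀ n x) 2 volume ≤ eLpNorm x 2 volume := by
  induction n with
  | zero => exact ⟨hx, le_rfl⟩
  | succ k ih =>
    have hc : Continuous (N.repr H₀ k x) := by
      rw [repr_eq_pooling]; exact continuous_pooling (N.scale_pos k) ih.1
    have hle : eLpNorm (N.unpooled H₀ (k + 1) x) 2 volume ≤ eLpNorm x 2 volume := by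
      calc eLpNorm (N.unpooled H₀ (k + 1) x) 2 volume
          = eLpNorm (patchExtraction (N.patch k) (N.repr H₀ k x)) 2 volume :=
            eLpNorm_congr_norm_ae (Eventually.of_forall fun u => norm_kernelMap _ _ _)
        _ ≤ eLpNorm (N.repr H₀ k x) 2 volume :=
            eLpNorm_patchExtraction_le (N.isCompact_patch k) (N.volume_patch_pos k) hc
        _ ≤ eLpNorm (N.unpooled H₀ k x) 2 volume := by
            rw [repr_eq_pooling]; exact eLpNorm_pooling_le (N.scale_pos k) ih.1.1
        _ ≤ _ := ih.2
    refine ⟨⟨?_, hle.trans_lt hx.2⟩, hle⟩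
    exact ((continuous_kernelMap _ _).comp (continuous_patchExtraction (N.isCompact_patch k)
      (N.volume_patch_pos k) hc)).aestronglyMeasurable

theorem continuous_repr (hx : MemLp x 2 volume) (n : ℕ) : Continuous (N.repr H₀ n x) := by
  rw [repr_eq_pooling]
  exact continuous_pooling (N.scale_pos n) (N.memLp_unpooled hx n).1

theorem memLp_repr (hx : MemLp x 2 volume) (n : ℕ) : MemLp (N.repr H₀ n x) 2 volume := by
  rw [repr_eq_pooling]
  exact memLp_pooling (N.scale_pos n) (N.memLp_unpooled hx n).1

end Architecture

/-! ### Accumulation of commutators over the layers. -/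

section Stability

variable {d : ℕ} {τ : Dom d → Dom d} {ε : ℝ}

theorem eLpNorm_pooling_add_sub_le {H : HilbertSp.{u}} {σ : ℝ} {y z : Dom d → H} (hσ : 0 < σ)
    (hy : MemLp y 2 volume) (hz : MemLp z 2 volume) (v : Dom d) :
    eLpNorm (fun u => pooling σ y (u + v) - pooling σ z (u + v)) 2 volume ≤
      eLpNorm (y - z) 2 volume := by
  simp only [← pooling_sub hσ hy hz]
  rw [eLpNorm_comp_add_right (continuous_pooling hσ (hy.sub hz))]
  exact eLpNorm_pooling_le hσ (hy.sub hz).1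

/-- If the commutator of pooling with the deformation is small, so is the difference between
pooling `y` after and pooling `z` before the deformation, whenever `y` is close to the
deformed `z`. -/
theorem eLpNorm_pooling_sub_pooling_comp_le {H : HilbertSp.{u}} {σ : ℝ} {y z : Dom d → H}
    (hσ : 0 < σ) (hτ : ContDiff ℝ 1 τ) (hy : MemLp y 2 volume) (hz : MemLp z 2 volume)
    (hzτ : MemLp (deform τ z) 2 volume) {v : Dom d} {M M' : ℝ≥0∞}
    (h : eLpNorm (y - deform τ z) 2 volume ≤ M)
    (h' : eLpNorm (fun u => pooling σ (deform τ z) (u + v) - pooling σ z (u - τ u + v)) 2 volume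
      ≤ M') :
    eLpNorm (fun u => pooling σ y (u + v) - pooling σ z (u - τ u + v)) 2 volume ≤ M + M' := by
  have hcy := continuous_pooling hσ hy
  have hcz := continuous_pooling hσ hz
  have hczτ := continuous_pooling hσ hzτ
  have hτc := hτ.continuous
  have e : (fun u => pooling σ y (u + v) - pooling σ z (u - τ u + v)) =
      (fun u => pooling σ y (u + v) - pooling σ (deform τ z) (u + v)) +
        fun u => pooling σ (deform τ z) (u + v) - pooling σ z (u - τ u + v) := by
    ext u; simp
  have hc1 : Continuous fun u => pooling σ y (u + v) - pooling σ (deform τ z) (u + v) := by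
    fun_prop
  have hc2 : Continuous fun u => pooling σ (deform τ z) (u + v) - pooling σ z (u - τ u + v) :=
    (hczτ.comp (by fun_prop)).sub (hcz.comp (by fun_prop))
  rw [e]
  refine (eLpNorm_add_le hc1.aestronglyMeasurable hc2.aestronglyMeasurable one_le_two).trans ?_
  exact add_le_add ((eLpNorm_pooling_add_sub_le hσ hy hzτ v).trans h) h'

/-- Each layer contributes one pooling commutator, shifted by points of its patch, and the
nonexpansive operators do not amplify the earlier error. Stopping before pooling starts the
induction at error `0`. -/
theorem eLpNorm_unpooled_deform_sub_le (N : Architecture d) {H₀ : HilbertSp.{u}} {n : ℕ}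
    {C : ℝ≥0∞} {κ : ℝ} (hκ : ∀ k < n, ∀ c ∈ N.patch k, ‖c‖ ≤ κ * N.scale k)
    (hτ : ContDiff ℝ 1 τ) (hε : ∀ u, ‖fderiv ℝ τ u‖ ≤ ε) (hε2 : ε ≤ 1 / 2)
    (hC : ∀ (H : HilbertSp.{u}) (σ : ℝ) (c : Dom d) (y : Dom d → H), 0 < σ → ‖c‖ ≤ κ * σ →
      MemLp y 2 volume →
      eLpNorm (fun u => pooling σ (deform τ y) (u + c) - pooling σ y (u - τ u + c)) 2 volume ≤
        C * eLpNorm y 2 volume)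
    {x : Dom d → H₀} (hx : MemLp x 2 volume) :
    eLpNorm (N.unpooled H₀ n (deform τ x) - deform τ (N.unpooled H₀ n x)) 2 volume ≤
      n * (C * eLpNorm x 2 volume) := by
  have hxτ := memLp_deform hτ hε hε2 hx
  induction n with
  | zero =>
    have : N.unpooled H₀ 0 (deform τ x) - deform τ (N.unpooled H₀ 0 x) = 0 := sub_self _
    simp [this]
  | succ k ih =>
    obtain ⟨hy, hyle⟩ := N.memLp_unpooled hx k
    have hy' := (N.memLp_unpooled hxτ k).1
    calc eLpNorm (N.unpooled H₀ (k + 1) (deform τ x) - deform τ (N.unpooled H₀ (k + 1) x)) 2 volume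
        ≤ eLpNorm (fun u => patchExtraction (N.patch k) (N.repr H₀ k (deform τ x)) u -
            patchExtraction (N.patch k) (N.repr H₀ k x) (u - τ u)) 2 volume :=
          -- The kernel mapping is pointwise, so the deformation passes through it to the patches.
          eLpNorm_mono fun u => norm_kernelMap_sub_le _ _ _ _
      _ ≤ k * (C * eLpNorm x 2 volume) + C * eLpNorm x 2 volume := by
          refine eLpNorm_patchExtraction_sub_le (N.isCompact_patch k) (N.volume_patch_pos k)
            (N.continuous_repr hxτ k) (N.continuous_repr hx k)
            (continuous_id.sub hτ.continuous) fun v hv => ?_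
          simp only [N.repr_eq_pooling]
          refine eLpNorm_pooling_sub_pooling_comp_le (N.scale_pos k) hτ hy' hy
            (memLp_deform hτ hε hε2 hy) (ih fun j hj => hκ j (hj.trans (Nat.lt_succ_self k))) ?_
          refine (hC _ _ v _ (N.scale_pos k) (hκ k (Nat.lt_succ_self k) v hv) hy).trans ?_
          exact mul_le_mul_right hyle C
      _ = _ := by push_cast; ring

end Stability

end ConvKernel

end

/-! ### The stability bound. -/

theorem theorem1 (d : ℕ) (κ : ℝ) (hκ : 0 < κ) :
    ∃ C₁ : ℝ, 0 ≤ C₁ ∧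
      ∀ (H₀ : ConvKernel.HilbertSp.{u}) (N : ConvKernel.Architecture d) (n : ℕ),
        (∀ k < n, ∀ c ∈ N.patch k, ‖c‖ ≤ κ * N.scale k) →
        ∀ τ : ConvKernel.Dom d → ConvKernel.Dom d, ContDiff ℝ 1 τ →
          ConvKernel.supGradNorm τ ≤ 1 / 2 →
          ∀ x : ConvKernel.Dom d → H₀, MemLp x 2 volume →
            MemLp (ConvKernel.deform τ x) 2 volume ∧
            MemLp (N.repr H₀ n x) 2 volume ∧
            MemLp (N.repr H₀ n (ConvKernel.deform τ x)) 2 volume ∧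
            eLpNorm (fun u => N.repr H₀ n (ConvKernel.deform τ x) u - N.repr H₀ n x u) 2 volume ≤
              (ENNReal.ofReal (C₁ * (1 + n)) * ConvKernel.supGradNorm τ +
                ENNReal.ofReal (ConvKernel.transConst d / N.scale n) * ConvKernel.supNorm τ) *
              eLpNorm x 2 volume := by
  obtain ⟨C, hC0, hC⟩ := ConvKernel.exists_eLpNorm_pooling_deform_sub_le.{u} d κ hκ
  refine ⟨C, hC0, fun H₀ N n hN τ hτ hg x hx => ?_⟩
  set ε : ℝ := (ConvKernel.supGradNorm τ).toReal with hεdef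
  have hfin : ConvKernel.supGradNorm τ ≠ ⊤ := ne_top_of_le_ne_top (by simp) hg
  have hε : ∀ u, ‖fderiv ℝ τ u‖ ≤ ε := fun u => by
    rw [hεdef, ← toReal_enorm]
    exact ENNReal.toReal_mono hfin (le_iSup (fun u => ‖fderiv ℝ τ u‖ₑ) u)
  have hε2 : ε ≤ 1 / 2 := by
    have := ENNReal.toReal_mono (by simp) hg
    simpa using this
  have hxτ := ConvKernel.memLp_deform hτ hε hε2 hx
  refine ⟨hxτ, N.memLp_repr hx n, N.memLp_repr hxτ n, ?_⟩
  have hcomm : ∀ (H : ConvKernel.HilbertSp.{u}) (σ : ℝ) (c : ConvKernel.Dom d)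
      (y : ConvKernel.Dom d → H), 0 < σ → ‖c‖ ≤ κ * σ → MemLp y 2 volume →
      eLpNorm (fun u => ConvKernel.pooling σ (ConvKernel.deform τ y) (u + c) -
        ConvKernel.pooling σ y (u - τ u + c)) 2 volume ≤
        ENNReal.ofReal (C * ε) * eLpNorm y 2 volume :=
    fun H σ c y hσ hc hy => hC H σ ε c τ y hσ hc hτ hε hε2 hy
  obtain ⟨hy, hyle⟩ := N.memLp_unpooled hx n
  have hy' := (N.memLp_unpooled hxτ n).1
  have hσ := N.scale_pos n
  have h1 := ConvKernel.eLpNorm_pooling_sub_pooling_comp_le hσ hτ hy' hy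
    (ConvKernel.memLp_deform hτ hε hε2 hy)
    (ConvKernel.eLpNorm_unpooled_deform_sub_le N hN hτ hε hε2 hcomm hx)
    -- The final pooling is followed by no patch, so the shift is `0`; this commutator is the `1` in
    -- `1 + n`.
    ((hcomm _ _ 0 _ hσ (by rw [norm_zero]; positivity) hy).trans (mul_le_mul_right hyle _))
  have h2 := (ConvKernel.eLpNorm_pooling_comp_id_sub_sub_le hσ hτ hε hε2 hy).trans
    (mul_le_mul_right hyle _)
  simp only [add_zero, ← N.repr_eq_pooling] at h1 h2
  have hτc := hτ.continuous
  have hcx := N.continuous_repr hx n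
  have hcx' := N.continuous_repr hxτ n
  -- Insert the deformed representation `L Φ_n(x)`: the first difference is governed by `∇τ`, the
  -- second by `τ` itself.
  have e : (fun u => N.repr H₀ n (ConvKernel.deform τ x) u - N.repr H₀ n x u) =
      (fun u => N.repr H₀ n (ConvKernel.deform τ x) u - N.repr H₀ n x (u - τ u)) +
        fun u => N.repr H₀ n x (u - τ u) - N.repr H₀ n x u := by
    ext u; simp
  rw [e]
  have hc : Continuous fun u => N.repr H₀ n x (u - τ u) := hcx.comp (by fun_prop)
  refine (eLpNorm_add_le (hcx'.sub hc).aestronglyMeasurable (hc.sub hcx).aestronglyMeasurable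
    one_le_two).trans ((add_le_add h1 h2).trans_eq ?_)
  rw [ENNReal.ofReal_mul hC0, ENNReal.ofReal_mul hC0, ENNReal.ofReal_add zero_le_one (by positivity),
    ENNReal.ofReal_one, ENNReal.ofReal_natCast, hεdef, ENNReal.ofReal_toReal hfin]
  ring
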